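/- Let $K$ be an algebraically closed field and let $H$ be a linear algebraic group over $K$, that is, a reduced affine group scheme of finite type over $K$ (not necessarily connected). Assume that $H$ satisfies at least one of the following two (in fact equivalent) conditions: (a) there is a (closed, not necessarily connected) normal subgroup $U$ of $H$, all of whose elements are unipotent, such that $H/U$ is abelian; (b) for every $n\ge 1$, every representation $H\to GL(n,K)$ has an $H$-eigenvector. Let $X$ and $Y$ be $K$-schemes with an action of $H$, and let $f\colon X\dashrightarrow Y$ be an $H$-equivariant rational map of $K$-schemes (defined on a dense open subset of $X$, with $f(hx)=h\,f(x)$ on a dense open subset of $H\times X$). Assume that $Y$ is proper over $K$ and that there is a $K$-point $x\in X(K)$ that is fixed by $H$ and at which $X$ is smooth over $K$. Then there is a $K$-point $y\in Y(K)$ that is fixed by $H$. -/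

import Mathlib

open CategoryTheory MonoidalCategory CartesianMonoidalCategory AlgebraicGeometry
open scoped MonObj

universe u

namespace GoingDown

/-! ### Linear algebraic groups over an algebraically closed field and their representations

Schemes over `K` are objects of `Over (Spec (.of K))`, group schemes are group objects there,
and `𝟙_ _ ⟶ X` is the set `X(K)` of `K`-points (a group if `X` is a group scheme). -/

section Groups

variable {K : Type u} [Field K]

/-- A linear algebraic group over an (algebraically closed) field: a reduced affine group scheme
of finite type. It need not be connected. -/
structure IsLinearAlgebraicGroup (H : Over (Spec (.of K))) [GrpObj H] : Prop where
  isAffine : IsAffine H.left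
  finiteType : LocallyOfFiniteType H.hom
  isReduced : IsReduced H.left

/-- The value at a `K`-point of a global regular function. -/
noncomputable def evalAt {X : Over (Spec (.of K))} (x : 𝟙_ (Over (Spec (.of K))) ⟶ X) :
    Γ(X.left, ⊤) →+* K :=
  ((Scheme.ΓSpecIso (.of K)).hom.hom).comp (x.left.appTop).hom

/-- A homomorphism `H(K) → GL(n, K)` is a representation of the linear algebraic group `H` if
its matrix entries are regular functions on `H`. -/
def IsRep {H : Over (Spec (.of K))} [GrpObj H] {n : ℕ}
    (ρ : (𝟙_ (Over (Spec (.of K))) ⟶ H) →* GL (Fin n) K) : Prop :=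
  ∀ i j, ∃ a : Γ(H.left, ⊤), ∀ g, (ρ g : Matrix (Fin n) (Fin n) K) i j = evalAt g a

/-- Every (nonzero, finite dimensional) representation of `H` has an `H`-eigenvector. -/
def RepsHaveEigenvectors (H : Over (Spec (.of K))) [GrpObj H] : Prop :=
  ∀ (n : ℕ) (ρ : (𝟙_ (Over (Spec (.of K))) ⟶ H) →* GL (Fin n) K), 0 < n → IsRep ρ →
    ∃ v : Fin n → K, v ≠ 0 ∧
      ∀ g, ∃ c : K, (ρ g : Matrix (Fin n) (Fin n) K).mulVec v = c • v

/-- An element of `H(K)` is unipotent if it acts unipotently in every representation of `H`. -/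
def IsUnipotentElt {H : Over (Spec (.of K))} [GrpObj H]
    (g : 𝟙_ (Over (Spec (.of K))) ⟶ H) : Prop :=
  ∀ (n : ℕ) (ρ : (𝟙_ (Over (Spec (.of K))) ⟶ H) →* GL (Fin n) K), IsRep ρ →
    IsNilpotent ((ρ g : Matrix (Fin n) (Fin n) K) - 1)

/-- A set of `K`-points of `X` is Zariski closed in `X(K)`. -/
def IsZariskiClosed {X : Over (Spec (.of K))} (A : Set (𝟙_ (Over (Spec (.of K))) ⟶ X)) : Prop :=
  ∃ Z : Set X.left, IsClosed Z ∧
    ∀ x : 𝟙_ (Over (Spec (.of K))) ⟶ X, x ∈ A ↔ x.left (IsLocalRing.closedPoint K) ∈ Z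

/-- `H` has a (closed, not necessarily connected) normal subgroup `U`, all of whose elements are
unipotent, such that `H / U` is abelian. -/
def IsUnipotentByAbelian (H : Over (Spec (.of K))) [GrpObj H] : Prop :=
  ∃ (U : Subgroup (𝟙_ (Over (Spec (.of K))) ⟶ H)) (_ : U.Normal),
    IsZariskiClosed (U : Set (𝟙_ (Over (Spec (.of K))) ⟶ H)) ∧
    (∀ g ∈ U, IsUnipotentElt g) ∧
    ∀ a b : (𝟙_ (Over (Spec (.of K))) ⟶ H) ⧸ U, a * b = b * a

end Groups

/-! ### Fixed points, smooth points, equivariant rational maps -/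

section Actions

variable {S : Scheme.{u}}

/-- The `S`-point `x` of `X` is fixed by `H`: for every `S`-scheme `T` and every `h ∈ H(T)`,
one has `h • x_T = x_T` in `X(T)`. -/
def IsFixedPoint (H : Over S) [GrpObj H] {X : Over S} [ModObj H X] (x : 𝟙_ (Over S) ⟶ X) : Prop :=
  ∀ (T : Over S) (h : T ⟶ H), h • (toUnit T ≫ x) = toUnit T ≫ x

/-- `X` is smooth over `S` at (all points of) the image of the `S`-point `x`. -/
def IsSmoothPoint {X : Over S} (x : 𝟙_ (Over S) ⟶ X) : Prop :=
  ∃ V : X.left.Opens, Set.range x.left ⊆ V ∧ Smooth (V.ι ≫ X.hom)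

/-- The domain of a partial map, as an `S`-scheme. -/
noncomputable abbrev domainOver {X Y : Over S} (g : X.left.PartialMap Y.left) : Over S :=
  Over.mk (g.domain.ι ≫ X.hom)

/-- The inclusion of the domain of a partial map, as an `S`-morphism. -/
noncomputable abbrev inclOver {X Y : Over S} (g : X.left.PartialMap Y.left) : domainOver g ⟶ X :=
  Over.homMk g.domain.ι

/-- A partial map compatible with the structure morphisms to `S`, as an `S`-morphism. -/
noncomputable abbrev homOver {X Y : Over S} (g : X.left.PartialMap Y.left)
    (hg : g.hom ≫ Y.hom = g.domain.ι ≫ X.hom) : domainOver g ⟶ Y :=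
  Over.homMk g.hom hg

/-- The rational map `f` is an `H`-equivariant rational map of `S`-schemes: it has a
representative `g` over `S` such that `g (h • x) = h • g x` for all `(h, x)` in a dense open
subset `W` of `H × X` for which `g` is defined at `x` and at `h • x`. Here `(h, x)` runs through
the `T`-points of `W`, for all `S`-schemes `T`. -/
def IsEquivariant (H : Over S) [GrpObj H] {X Y : Over S} [ModObj H X] [ModObj H Y]
    (f : X.left ⤏ Y.left) : Prop :=
  ∃ (g : X.left.PartialMap Y.left) (hg : g.hom ≫ Y.hom = g.domain.ι ≫ X.hom),
    g.toRationalMap = f ∧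
    ∃ W : (H ⊗ X).left.Opens, Dense (W : Set (H ⊗ X).left) ∧
      ∀ (T : Over S) (h : T ⟶ H) (x x' : T ⟶ domainOver g),
        Set.range (lift h (x ≫ inclOver g)).left ⊆ W →
        x' ≫ inclOver g = h • (x ≫ inclOver g) →
        x' ≫ homOver g hg = h • (x ≫ homOver g hg)

end Actions

end GoingDown

/-! The fixed point of `Y` is a limit of `f` at `x` along an `H`-invariant valuation centred at `x`
with residue field `K`. Since `X` is smooth at `x`, an étale chart gives formal coordinates there,
and since `x` is fixed, `H(K)` acts on the formal germ K[[X_1, …, X_d]]. The linear terms of this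
action form a representation of `H`. By the eigenvector condition, which follows from condition (a)
by the Lie–Kolchin theorem, this representation is triangular in suitable coordinates
(`exists_triangular_germ`). Each group element then preserves the leading exponent of every
coordinate for the graded lexicographic order, hence that of every power series
(`degLexOrder_subst`). The leading exponent is a valuation whose graded pieces are lines, so its
valuation ring O has residue field `K`, and the group acts on O trivially modulo the maximal ideal
(`exists_extension`). The fraction field L of K[[X_1, …, X_d]] gives a point over a generic point of
`X`, where `f` is defined. As `Y` is proper, the resulting L-point of `Y` extends to Spec O, and its
value at the closed point is a `K`-point y (`exists_invariant_point`). Equivariance holds at the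
generic point for a dense set of h in `H(K)`, so these h fix y. Since `H` is reduced and `Y` is
separated, all of `H` fixes y (`isFixedPoint_of_dense`). -/

namespace GoingDown

/-! ### The graded lexicographic order of a power series -/

section DegLexOrder

open Finsupp

variable {σ : Type*} [LinearOrder σ] [Finite σ] {K : Type*} [Field K]

/-- Power series in finitely many variables are Hahn series for the graded lexicographic order
of the exponents. -/
noncomputable def degLexHahn :
    MvPowerSeries σ K ≃+* HahnSeries (DegLex (σ →₀ ℕ)) K where
  -- With finitely many variables the graded lexicographic order is a well-order, so there is no
  -- condition on supports.
  toFun p := ⟨fun e ↦ MvPowerSeries.coeff (ofDegLex e) p, Set.isPWO_of_wellQuasiOrderedLE _⟩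
  invFun f := fun e ↦ f.coeff (toDegLex e)
  left_inv _ := rfl
  right_inv _ := rfl
  map_add' p q := by ext; simp
  map_mul' p q := by
    ext n
    classical
      simp_rw [HahnSeries.coeff_mul]
      rw [MvPowerSeries.coeff_mul]
      -- One product sums over all pairs of exponents with sum n, the other over pairs in the
      -- supports. The index sets agree once the zero terms are dropped.
      refine (Finset.sum_filter_ne_zero _).symm.trans <|
        (Finset.sum_congr ?_ fun _ _ ↦ rfl).trans <| Finset.sum_filter_ne_zero _
      ext m
      refine ⟨fun hm ↦ ?_, fun hm ↦ ?_⟩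
      · obtain ⟨h1, h⟩ := Finset.mem_filter.mp hm
        exact (Finset.mem_filter (α := DegLex (σ →₀ ℕ) × DegLex (σ →₀ ℕ))).mpr
          ⟨(Set.Finite.mem_toFinset _).mpr ⟨left_ne_zero_of_mul h, right_ne_zero_of_mul h,
            (Finset.HasAntidiagonal.mem_antidiagonal (A := σ →₀ ℕ)).mp h1⟩, h⟩
      · obtain ⟨h1, h⟩ := (Finset.mem_filter (α := DegLex (σ →₀ ℕ) × DegLex (σ →₀ ℕ))).mp hm
        exact Finset.mem_filter.mpr ⟨Finset.HasAntidiagonal.mem_antidiagonal.mpr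
          ((Set.Finite.mem_toFinset _).mp h1).2.2, h⟩

/-- The least exponent of a power series, for the graded lexicographic order. -/
noncomputable def degLexOrder (p : MvPowerSeries σ K) : WithTop (DegLex (σ →₀ ℕ)) :=
  (degLexHahn p).orderTop

lemma degLexOrder_eq_top {p : MvPowerSeries σ K} : degLexOrder p = ⊤ ↔ p = 0 := by
  simp [degLexOrder]

lemma degLexOrder_mul (p q : MvPowerSeries σ K) :
    degLexOrder (p * q) = degLexOrder p + degLexOrder q := by
  simp [degLexOrder, HahnSeries.orderTop_mul]

lemma min_degLexOrder_le_add (p q : MvPowerSeries σ K) :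
    min (degLexOrder p) (degLexOrder q) ≤ degLexOrder (p + q) := by
  rw [degLexOrder, degLexOrder, degLexOrder, map_add]
  exact HahnSeries.min_orderTop_le_orderTop_add

lemma coeff_eq_zero_of_lt_degLexOrder {p : MvPowerSeries σ K} {e : σ →₀ ℕ}
    (h : WithTop.some (toDegLex e) < degLexOrder p) :
    MvPowerSeries.coeff e p = 0 :=
  HahnSeries.coeff_eq_zero_of_lt_orderTop (x := degLexHahn p) (i := toDegLex e) h

lemma degLexOrder_eq_coe_iff {p : MvPowerSeries σ K} {e : σ →₀ ℕ} :
    degLexOrder p = WithTop.some (toDegLex e) ↔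
      MvPowerSeries.coeff e p ≠ 0 ∧
        ∀ b, toDegLex b < toDegLex e → MvPowerSeries.coeff b p = 0 := by
  refine ⟨fun h ↦ ⟨HahnSeries.coeff_orderTop_ne (x := degLexHahn p) h, fun b hb ↦
    coeff_eq_zero_of_lt_degLexOrder (h ▸ WithTop.coe_lt_coe.mpr hb)⟩, fun ⟨h, h'⟩ ↦ ?_⟩
  refine HahnSeries.orderTop_eq_of_le (x := degLexHahn p) (g := toDegLex e) h fun b hb ↦ ?_
  by_contra hlt
  exact hb (h' (ofDegLex b) (not_le.mp hlt))

lemma degLexOrder_one : degLexOrder (1 : MvPowerSeries σ K) = 0 := by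
  simp [degLexOrder]

lemma degLexOrder_finsuppProd {a : σ → MvPowerSeries σ K}
    (ha : ∀ i, degLexOrder (a i) = WithTop.some (toDegLex (single i 1)))
    (e : σ →₀ ℕ) :
    degLexOrder (e.prod fun s n ↦ a s ^ n) = WithTop.some (toDegLex e) := by
  induction e using Finsupp.induction_linear with
  | zero => exact degLexOrder_one
  | add f g hf hg =>
    rw [Finsupp.prod_add_index' (by simp) (by simp [pow_add]), degLexOrder_mul, hf, hg,
      toDegLex_add, WithTop.coe_add]
  | single s n =>
    rw [Finsupp.prod_single_index (by simp)]
    induction n with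
    | zero => rw [pow_zero, Finsupp.single_zero]; exact degLexOrder_one
    | succ n ih =>
      rw [pow_succ, degLexOrder_mul, ih, ha, Finsupp.single_add, toDegLex_add, WithTop.coe_add]

/-- A substitution preserves the least exponent of every power series if it does so for the
variables. -/
lemma degLexOrder_subst {a : σ → MvPowerSeries σ K} (hs : MvPowerSeries.HasSubst a)
    (ha : ∀ i, degLexOrder (a i) = WithTop.some (toDegLex (single i 1)))
    (p : MvPowerSeries σ K) : degLexOrder (MvPowerSeries.subst a p) = degLexOrder p := by
  by_cases hp : p = 0
  · rw [hp, ← MvPowerSeries.coe_substAlgHom hs, map_zero]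
  obtain ⟨e, he⟩ := WithTop.ne_top_iff_exists.mp (degLexOrder_eq_top.not.mpr hp)
  induction e with | _ e
  have hmon (b : σ →₀ ℕ) := degLexOrder_eq_coe_iff.mp (degLexOrder_finsuppProd ha b)
  obtain ⟨h1, h2⟩ := degLexOrder_eq_coe_iff.mp he.symm
  -- The monomial of exponent d goes to a series of order d. In the coefficient at e, terms with d <
  -- e vanish because p has order e, and terms with d > e because their series starts later. Below e
  -- every term vanishes.
  rw [← he, degLexOrder_eq_coe_iff, MvPowerSeries.coeff_subst hs, finsum_eq_single _ e]
  · refine ⟨mul_ne_zero h1 (hmon e).1, fun b hb ↦ ?_⟩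
    rw [MvPowerSeries.coeff_subst hs, finsum_eq_zero_of_forall_eq_zero fun d ↦ ?_]
    rcases lt_or_ge (toDegLex d) (toDegLex e) with hd | hd
    · rw [h2 d hd, zero_smul]
    · rw [(hmon d).2 b (hb.trans_le hd), smul_zero]
  · intro d hd
    rcases lt_or_gt_of_ne (toDegLex_injective.ne hd) with hd | hd
    · rw [h2 d hd, zero_smul]
    · rw [(hmon d).2 e hd, smul_zero]

end DegLexOrder

/-! ### The valuation ring of an order function -/

section OrderFunction

/-- An additive valuation that is nonnegative on `P`, and whose graded pieces are lines over `K`. -/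
structure IsLineOrder (K : Type*) [Field K] {P : Type*} [CommRing P] [Algebra K P]
    {Γ : Type*} [AddCommMonoid Γ] [LinearOrder Γ] (w : P → WithTop Γ) : Prop where
  eq_top {p : P} : w p = ⊤ ↔ p = 0
  mul (p q : P) : w (p * q) = w p + w q
  min_le_add (p q : P) : min (w p) (w q) ≤ w (p + q)
  nonneg (p : P) : w 1 ≤ w p
  exists_lt {p q : P} (hq : q ≠ 0) (h : w q ≤ w p) : ∃ c : K, w q < w (p - c • q)

namespace IsLineOrder

variable {K : Type*} [Field K] {P : Type u} [CommRing P] [Algebra K P]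
  {Γ : Type*} [AddCommMonoid Γ] [LinearOrder Γ] [IsOrderedCancelAddMonoid Γ] {w : P → WithTop Γ}

lemma add_le_add_iff (hw : IsLineOrder K w) {p q r : P} (hr : r ≠ 0) :
    w (p * r) ≤ w (q * r) ↔ w p ≤ w q := by
  rw [hw.mul, hw.mul]
  exact WithTop.add_le_add_iff_right (hw.eq_top.not.mpr hr)

lemma neg_one_eq (hw : IsLineOrder K w) [Nontrivial P] : w (-1 : P) = w 1 := by
  refine le_antisymm ?_ (hw.nonneg _)
  have h := hw.nonneg (-1)
  have h1 : w (1 : P) + w 1 = w 1 := by rw [← hw.mul, one_mul]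
  have h2 : w (-1 : P) + w (-1) = w 1 := by rw [← hw.mul]; simp
  have h3 : w (-1 : P) + w 1 = w (-1) := by rw [← hw.mul]; simp
  calc w (-1 : P) = w (-1) + w 1 := h3.symm
    _ ≤ w (-1) + w (-1) := by gcongr
    _ = w 1 := h2

/-- If `a / b = a' / b'` then `b ≤ a` if and only if `b' ≤ a'`. -/
lemma le_iff_le (hw : IsLineOrder K w) {a b a' b' : P} (hb : b ≠ 0) (hb' : b' ≠ 0)
    (h : a * b' = a' * b) : w b ≤ w a ↔ w b' ≤ w a' := by
  rw [← hw.add_le_add_iff hb', h, mul_comm b b', hw.add_le_add_iff hb]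

variable [IsDomain P]

/-- The valuation ring of an additive valuation. -/
noncomputable def valuationSubring (hw : IsLineOrder K w) :
    ValuationSubring (FractionRing P) where
  carrier := {z | ∃ a b : P, b ≠ 0 ∧ w b ≤ w a ∧
    z * algebraMap P (FractionRing P) b = algebraMap P (FractionRing P) a}
  mul_mem' := by
    rintro y z ⟨a, b, hb, hab, h⟩ ⟨a', b', hb', hab', h'⟩
    refine ⟨a * a', b * b', mul_ne_zero hb hb', ?_, ?_⟩
    · rw [hw.mul, hw.mul]; gcongr
    · rw [map_mul, map_mul, ← h, ← h']; ring
  one_mem' := ⟨1, 1, one_ne_zero, le_rfl, by simp⟩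
  add_mem' := by
    rintro y z ⟨a, b, hb, hab, h⟩ ⟨a', b', hb', hab', h'⟩
    refine ⟨a * b' + a' * b, b * b', mul_ne_zero hb hb',
      (le_min ?_ ?_).trans (hw.min_le_add _ _), ?_⟩
    · rw [hw.mul, hw.mul]; gcongr
    · rw [hw.mul, hw.mul, add_comm]; gcongr
    · simp only [map_mul, map_add, ← h, ← h']; ring
  zero_mem' := ⟨0, 1, one_ne_zero, hw.nonneg _, by simp⟩
  neg_mem' := by
    rintro y ⟨a, b, hb, hab, h⟩
    refine ⟨-1 * a, b, hb, ?_, by simp [h]⟩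
    rwa [hw.mul, hw.neg_one_eq, ← hw.mul, one_mul]
  mem_or_inv_mem' z := by
    obtain ⟨a, b, hb, rfl⟩ := IsFractionRing.div_surjective (A := P) z
    have hb : b ≠ 0 := nonZeroDivisors.ne_zero hb
    have hb' : algebraMap P (FractionRing P) b ≠ 0 := by simpa using hb
    rcases eq_or_ne a 0 with rfl | ha
    · exact Or.inl ⟨0, 1, one_ne_zero, hw.nonneg _, by simp⟩
    have ha' : algebraMap P (FractionRing P) a ≠ 0 := by simpa using ha
    rcases le_total (w b) (w a) with h | h
    · exact Or.inl ⟨a, b, hb, h, by field_simp⟩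
    · exact Or.inr ⟨b, a, ha, h, by field_simp⟩

/-- By `le_iff_le`, the comparison of orders does not depend on the fraction that represents z. -/
lemma mem_valuationSubring_iff (hw : IsLineOrder K w) {z : FractionRing P} {a b : P} (hb : b ≠ 0)
    (h : z * algebraMap P (FractionRing P) b = algebraMap P (FractionRing P) a) :
    z ∈ hw.valuationSubring ↔ w b ≤ w a := by
  refine ⟨fun ⟨a', b', hb', hab', h'⟩ ↦ ?_, fun hab ↦ ⟨a, b, hb, hab, h⟩⟩
  refine (hw.le_iff_le hb hb' ?_).mpr hab'
  apply IsFractionRing.injective P (FractionRing P)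
  rw [map_mul, map_mul, ← h, ← h']; ring

lemma inv_mem_valuationSubring_iff (hw : IsLineOrder K w) {z : FractionRing P} {a b : P}
    (hz : z ≠ 0) (hb : b ≠ 0)
    (h : z * algebraMap P (FractionRing P) b = algebraMap P (FractionRing P) a) :
    z⁻¹ ∈ hw.valuationSubring ↔ w a ≤ w b := by
  refine hw.mem_valuationSubring_iff (fun h0 ↦ ?_) ?_
  · rw [h0, map_zero] at h
    exact mul_ne_zero hz (by simpa using hb) h
  · rw [← h, inv_mul_cancel_left₀ hz]

lemma algebraMap_mem_valuationSubring (hw : IsLineOrder K w) (p : P) :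
    algebraMap P (FractionRing P) p ∈ hw.valuationSubring :=
  ⟨p, 1, one_ne_zero, hw.nonneg p, by simp⟩

/-- The inclusion of `P` into its valuation ring. -/
noncomputable def toValuationSubring (hw : IsLineOrder K w) : P →+* hw.valuationSubring :=
  (algebraMap P (FractionRing P)).codRestrict _ hw.algebraMap_mem_valuationSubring

noncomputable instance (hw : IsLineOrder K w) : Algebra K hw.valuationSubring :=
  (hw.toValuationSubring.comp (algebraMap K P)).toAlgebra

lemma coe_algebraMap (hw : IsLineOrder K w) (c : K) :
    (algebraMap K hw.valuationSubring c : FractionRing P) =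
      algebraMap P (FractionRing P) (algebraMap K P c) := rfl

lemma mem_maximalIdeal_iff (hw : IsLineOrder K w) {z : hw.valuationSubring} {a b : P} (hb : b ≠ 0)
    (h : z * algebraMap P (FractionRing P) b = algebraMap P (FractionRing P) a) :
    z ∈ IsLocalRing.maximalIdeal hw.valuationSubring ↔ w b < w a := by
  rw [IsLocalRing.mem_maximalIdeal, mem_nonunits_iff, ← not_le]
  refine not_congr ?_
  have hb' : algebraMap P (FractionRing P) b ≠ 0 := by simpa using hb
  by_cases hz : (z : FractionRing P) = 0
  · have ha : a = 0 := by simpa [hz] using h.symm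
    have hz' : z = 0 := Subtype.ext hz
    have hbt : w b ≠ ⊤ := hw.eq_top.not.mpr hb
    simp [hz', ha, hw.eq_top.mpr rfl, hbt]
  · rw [← hw.inv_mem_valuationSubring_iff hz hb h]
    constructor
    · rintro ⟨u, rfl⟩
      have : ((u : hw.valuationSubring) : FractionRing P)⁻¹ = ((u⁻¹ : hw.valuationSubringˣ) :
          hw.valuationSubring) := by
        rw [inv_eq_iff_eq_inv, eq_comm, inv_eq_of_mul_eq_one_left]
        exact congrArg Subtype.val u.mul_inv
      rw [this]
      exact Subtype.property _
    · intro hinv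
      exact IsUnit.of_mul_eq_one ⟨_, hinv⟩ (Subtype.ext (mul_inv_cancel₀ hz))

lemma exists_rep (hw : IsLineOrder K w) (z : hw.valuationSubring) : ∃ a b : P, b ≠ 0 ∧
    w b ≤ w a ∧ z * algebraMap P (FractionRing P) b = algebraMap P (FractionRing P) a :=
  z.2

/-- For a fraction a / b in the ring, `exists_lt` gives a constant c such that a - c b has larger
order than b. So a / b is congruent to c, and the closed point of the valuation ring is a `K`-point.
-/
lemma algebraMap_residueField_bijective (hw : IsLineOrder K w) :
    Function.Bijective (algebraMap K (IsLocalRing.ResidueField hw.valuationSubring)) := by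
  refine ⟨RingHom.injective _, fun z ↦ ?_⟩
  obtain ⟨z, rfl⟩ := IsLocalRing.residue_surjective z
  obtain ⟨a, b, hb, hab, h⟩ := hw.exists_rep z
  obtain ⟨c, hc⟩ := hw.exists_lt hb hab
  refine ⟨c, ?_⟩
  rw [IsScalarTower.algebraMap_apply K hw.valuationSubring]
  refine (Ideal.Quotient.eq.mpr ?_).symm
  rw [hw.mem_maximalIdeal_iff (a := a - c • b) hb]
  · exact hc
  · change (z - (algebraMap K hw.valuationSubring c : FractionRing P)) * _ = _
    rw [sub_mul, h, coe_algebraMap, map_sub, Algebra.smul_def, map_mul]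

/-- The `K`-point of the valuation ring. -/
noncomputable def residueHom (hw : IsLineOrder K w) : hw.valuationSubring →ₐ[K] K :=
  (AlgEquiv.ofBijective (Algebra.ofId K _) hw.algebraMap_residueField_bijective).symm.toAlgHom.comp
    (IsScalarTower.toAlgHom K hw.valuationSubring _)

lemma residueHom_eq_zero_iff (hw : IsLineOrder K w) {z : hw.valuationSubring} :
    hw.residueHom z = 0 ↔ z ∈ IsLocalRing.maximalIdeal hw.valuationSubring := by
  rw [← IsLocalRing.residue_eq_zero_iff]
  simp [residueHom]

/-- An endomorphism that preserves the order extends to the valuation ring. -/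
theorem exists_extension (hw : IsLineOrder K w) {ψ : P →ₐ[K] P} (hψ : ∀ p, w (ψ p) = w p) :
    ∃ ψ' : hw.valuationSubring →ₐ[K] hw.valuationSubring, Function.Injective ψ' ∧
      (∀ p, ψ' (hw.toValuationSubring p) = hw.toValuationSubring (ψ p)) ∧
      hw.residueHom.comp ψ' = hw.residueHom := by
  have h0 {p : P} : ψ p = 0 ↔ p = 0 := by rw [← hw.eq_top, hψ, hw.eq_top]
  have hinj : Function.Injective ψ := (injective_iff_map_eq_zero ψ).mpr fun p ↦ h0.mp
  let F : FractionRing P →+* FractionRing P := IsFractionRing.map (j := ψ.toRingHom) hinj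
  have hF (p : P) : F (algebraMap P _ p) = algebraMap P _ (ψ p) :=
    IsLocalization.map_eq _ _
  have hrep (z : hw.valuationSubring) {a b : P}
      (h : z * algebraMap P (FractionRing P) b = algebraMap P (FractionRing P) a) :
      F z * algebraMap P (FractionRing P) (ψ b) = algebraMap P (FractionRing P) (ψ a) := by
    rw [← hF, ← hF, ← map_mul, h]
  have hmem (z : hw.valuationSubring) : F z ∈ hw.valuationSubring := by
    obtain ⟨a, b, hb, hab, h⟩ := hw.exists_rep z
    rw [hw.mem_valuationSubring_iff (h0.not.mpr hb) (hrep z h), hψ, hψ]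
    exact hab
  let F' : hw.valuationSubring →+* hw.valuationSubring :=
    (F.comp (algebraMap _ _)).codRestrict _ hmem
  have hF' (p : P) : F' (hw.toValuationSubring p) = hw.toValuationSubring (ψ p) :=
    Subtype.ext (hF p)
  let ψ' : hw.valuationSubring →ₐ[K] hw.valuationSubring :=
    { F' with commutes' := fun c ↦ (hF' _).trans (by rw [ψ.commutes]; rfl) }
  refine ⟨ψ', fun x y hxy ↦ Subtype.ext (F.injective (congrArg Subtype.val hxy)), hF', ?_⟩
  ext z
  -- Constants are fixed, so it is enough that the extension preserves the maximal ideal. It does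
  -- because the orders of numerator and denominator are preserved.
  have hz : z - algebraMap K _ (hw.residueHom z) ∈
      IsLocalRing.maximalIdeal hw.valuationSubring := by
    rw [← hw.residueHom_eq_zero_iff, map_sub, AlgHom.commutes]
    exact sub_self _
  generalize hw.residueHom z = c at *
  obtain ⟨a, b, hb, hab, h⟩ := hw.exists_rep (z - algebraMap K _ c)
  have h2 : ψ' (z - algebraMap K _ c) ∈ IsLocalRing.maximalIdeal hw.valuationSubring := by
    rw [hw.mem_maximalIdeal_iff hb h] at hz
    rw [hw.mem_maximalIdeal_iff (h0.not.mpr hb) (hrep _ h), hψ, hψ]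
    exact hz
  rw [map_sub, AlgHom.commutes, ← hw.residueHom_eq_zero_iff, map_sub, AlgHom.commutes,
    sub_eq_zero] at h2
  exact h2

end IsLineOrder

open Finsupp in
lemma isLineOrder_degLexOrder {σ : Type*} [LinearOrder σ] [Finite σ] {K : Type*} [Field K] :
    IsLineOrder K (degLexOrder (σ := σ) (K := K)) where
  eq_top := degLexOrder_eq_top
  mul := degLexOrder_mul
  min_le_add := min_degLexOrder_le_add
  nonneg p := by
    rw [degLexOrder_one]
    exact bot_le
  exists_lt {p q} hq h := by
    obtain ⟨e, he⟩ := WithTop.ne_top_iff_exists.mp (degLexOrder_eq_top.not.mpr hq)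
    induction e with | _ e
    obtain ⟨h1, h2⟩ := degLexOrder_eq_coe_iff.mp he.symm
    -- This constant cancels the coefficient at e, the leading exponent of q. All smaller
    -- coefficients vanish in both series.
    refine ⟨MvPowerSeries.coeff e p / MvPowerSeries.coeff e q, ?_⟩
    set c := MvPowerSeries.coeff e p / MvPowerSeries.coeff e q
    by_contra hlt
    have hne : degLexOrder (p - c • q) ≠ ⊤ := fun htop ↦ by
      rw [htop, ← he] at hlt
      exact hlt (WithTop.coe_lt_top _)
    obtain ⟨b, hb⟩ := WithTop.ne_top_iff_exists.mp hne
    induction b with | _ b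
    obtain ⟨h3, -⟩ := degLexOrder_eq_coe_iff.mp hb.symm
    rw [← hb, ← he, not_lt, WithTop.coe_le_coe] at hlt
    apply h3
    rcases hlt.eq_or_lt with hbe | hbe
    · obtain rfl := toDegLex_injective hbe
      simp [c, h1]
    · have := coeff_eq_zero_of_lt_degLexOrder ((WithTop.coe_lt_coe.mpr hbe).trans_le (he ▸ h))
      simp [h2 b hbe, this]

end OrderFunction
/-! ### Common eigenvectors -/

section LinearAlgebra

variable {K : Type*} [Field K] [IsAlgClosed K] {V : Type*} [AddCommGroup V] [Module K V]
  [FiniteDimensional K V]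

omit [IsAlgClosed K] in
lemma exists_isSimpleModule_submodule [Nontrivial V] (A : Subalgebra K (Module.End K V)) :
    ∃ W : Submodule A V, IsSimpleModule A W := by
  have : IsArtinian A V := isArtinian_of_tower K inferInstance
  obtain ⟨W, hW⟩ := IsAtomic.exists_atom (Submodule A V)
  exact ⟨W, isSimpleModule_iff_isAtom.mpr hW⟩

/-- Burnside's theorem. -/
lemma lsmul_surjective_of_isSimpleModule {A W : Type*} [Ring A] [Algebra K A] [AddCommGroup W]
    [Module K W] [FiniteDimensional K W] [Module A W] [IsScalarTower K A W] [IsSimpleModule A W] :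
    Function.Surjective (Algebra.lsmul K K W : A →ₐ[K] Module.End K W) := by
  intro f
  -- By Schur's lemma the commutant consists of scalars, so every `K`-linear f commutes with it. The
  -- density theorem then realises f by an element of A.
  have hs := IsSimpleModule.algebraMap_end_bijective_of_isAlgClosed (A := A) (V := W) K
  let f' : Module.End (Module.End A W) W :=
    { f with
      map_smul' := fun t w ↦ by
        obtain ⟨c, rfl⟩ := hs.2 t
        exact f.map_smul c w }
  have : Module.Finite (Module.End A W) W := Module.Finite.of_restrictScalars_finite K _ _
  obtain ⟨a, ha⟩ := Module.Finite.toModuleEnd_moduleEnd_surjective (R := A) (M := W) f'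
  exact ⟨a, LinearMap.ext fun w ↦ congr($ha w)⟩

/-- A group of unipotent elements that spans `A` acts trivially on every simple module. -/
lemma smul_eq_of_isSimpleModule {A W : Type*} [Ring A] [Algebra K A] [AddCommGroup W]
    [Module K W] [FiniteDimensional K W] [Module A W] [IsScalarTower K A W] [IsSimpleModule A W]
    {G : Type*} [Monoid G] (a : G →* A) (ha : ∀ g, IsNilpotent (a g - 1))
    (hspan : Submodule.span K (Set.range a) = ⊤) (g : G) (w : W) : a g • w = w := by
  let T : A →ₐ[K] Module.End K W := Algebra.lsmul K K W
  have htr (g : G) : LinearMap.trace K W (T (a g - 1)) = 0 :=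
    (LinearMap.isNilpotent_trace_of_isNilpotent ((ha g).map T)).eq_zero
  -- On the spanning elements, (a g - 1) a h is a difference of two nilpotents, so its trace is
  -- zero.
  have htr' (x : A) : LinearMap.trace K W (T ((a g - 1) * x)) = 0 := by
    have hx : x ∈ Submodule.span K (Set.range a) := hspan ▸ Submodule.mem_top
    induction hx using Submodule.span_induction with
    | mem x hx =>
      obtain ⟨h, rfl⟩ := hx
      have h1 : (a g - 1) * a h = (a (g * h) - 1) - (a h - 1) := by
        rw [sub_mul, one_mul, sub_sub_sub_cancel_right, map_mul]
      rw [h1, map_sub, map_sub, htr, htr, sub_zero]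
    | zero => simp
    | add x y _ _ hx hy => rw [mul_add, map_add, map_add, hx, hy, add_zero]
    | smul c x _ hx => rw [mul_smul_comm, map_smul, map_smul, hx, smul_zero]
  rw [← sub_eq_zero, ← one_smul A w, smul_smul, mul_one, ← sub_smul,
    ← Module.forall_dual_apply_eq_zero_iff K]
  intro φ
  -- By Burnside some x acts as the rank-one operator z ↦ φ(z) w. The vanishing trace of (a g - 1) x
  -- is then φ((a g - 1) w).
  obtain ⟨x, hx⟩ := lsmul_surjective_of_isSimpleModule (K := K) (A := A) (φ.smulRight w)
  have h := htr' x
  have h2 : T ((a g - 1) * x) = φ.smulRight ((a g - 1) • w) := by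
    ext1 z
    have : x • z = φ z • w := congr($hx z)
    change ((a g - 1) * x) • z = φ z • (a g - 1) • w
    rw [mul_smul, this, smul_comm]
  rwa [h2, LinearMap.trace_smulRight] at h

lemma exists_smul_eq_smul_of_isMulCommutative {A W : Type*} [Ring A] [Algebra K A]
    [AddCommGroup W] [Module K W] [FiniteDimensional K W] [Module A W] [IsScalarTower K A W]
    [IsSimpleModule A W] [IsMulCommutative A] :
    ∃ w : W, w ≠ 0 ∧ ∀ a : A, ∃ c : K, a • w = c • w := by
  obtain ⟨w, hw, hspan⟩ := finrank_eq_one_iff'.mp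
    (IsSimpleModule.finrank_eq_one_of_isMulCommutative A W K)
  refine ⟨w, hw, fun a ↦ ?_⟩
  obtain ⟨c, hc⟩ := hspan (a • w)
  exact ⟨c, hc.symm⟩

/-- Kolchin's theorem: a group of unipotent endomorphisms has a common fixed vector. -/
theorem exists_fixed_of_isNilpotent_sub_one [Nontrivial V] {G : Type*} [Monoid G]
    (ρ : G →* Module.End K V) (hρ : ∀ g, IsNilpotent (ρ g - 1)) :
    ∃ v : V, v ≠ 0 ∧ ∀ g, ρ g v = v := by
  obtain ⟨W, hW⟩ := exists_isSimpleModule_submodule (Algebra.adjoin K (Set.range ρ))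
  have : FiniteDimensional K W := inferInstanceAs (FiniteDimensional K (W.restrictScalars K))
  let a : G →* Algebra.adjoin K (Set.range ρ) :=
    ρ.codRestrict _ fun g ↦ Algebra.subset_adjoin ⟨g, rfl⟩
  have ha (g : G) : IsNilpotent (a g - 1) :=
    (IsNilpotent.map_iff (f := (Algebra.adjoin K (Set.range ρ)).val)
      Subtype.val_injective).mp (hρ g)
  -- The range of ρ is closed under products, so its linear span is already the algebra it
  -- generates.
  have hspan : Submodule.span K (Set.range a) = ⊤ := by
    rw [eq_top_iff]
    intro x _
    have hS : Subalgebra.toSubmodule (Algebra.adjoin K (Set.range ρ)) =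
        Submodule.span K (Set.range ρ) := by
      rw [Algebra.adjoin_eq_span, ← MonoidHom.coe_mrange, Submonoid.closure_eq]
    have hx : (x : Module.End K V) ∈ Submodule.span K (Set.range ρ) := hS.le x.2
    have h1 : (Submodule.span K (Set.range a)).map
        (Algebra.adjoin K (Set.range ρ)).val.toLinearMap = Submodule.span K (Set.range ρ) := by
      rw [Submodule.map_span, ← Set.range_comp]
      rfl
    rw [← h1] at hx
    obtain ⟨y, hy, hyx⟩ := hx
    obtain rfl : y = x := Subtype.ext hyx
    exact hy
  have := IsSimpleModule.nontrivial (Algebra.adjoin K (Set.range ρ)) W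
  obtain ⟨w, hw⟩ := exists_ne (0 : W)
  exact ⟨w, by simpa using hw, fun g ↦
    congrArg Subtype.val (smul_eq_of_isSimpleModule (K := K) a ha hspan g w)⟩

/-- A group of commuting endomorphisms has a common eigenvector. -/
theorem exists_eigenvector_of_commute [Nontrivial V] {G : Type*} [Monoid G]
    (ρ : G →* Module.End K V) (hρ : ∀ g h, ρ g * ρ h = ρ h * ρ g) :
    ∃ v : V, v ≠ 0 ∧ ∀ g, ∃ c : K, ρ g v = c • v := by
  obtain ⟨W, hW⟩ := exists_isSimpleModule_submodule (Algebra.adjoin K (Set.range ρ))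
  have : FiniteDimensional K W := inferInstanceAs (FiniteDimensional K (W.restrictScalars K))
  have : IsMulCommutative (Algebra.adjoin K (Set.range ρ)) := Algebra.isMulCommutative_adjoin K (by
    rintro _ ⟨g, rfl⟩ _ ⟨h, rfl⟩
    exact hρ g h)
  obtain ⟨w, hw, h⟩ := exists_smul_eq_smul_of_isMulCommutative (K := K)
    (A := Algebra.adjoin K (Set.range ρ)) (W := W)
  refine ⟨w, by simpa using hw, fun g ↦ ?_⟩
  obtain ⟨c, hc⟩ := h ⟨ρ g, Algebra.subset_adjoin ⟨g, rfl⟩⟩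
  exact ⟨c, congrArg Subtype.val hc⟩

/-- The Lie–Kolchin theorem for groups that are extensions of abelian groups by groups of
unipotent endomorphisms. -/
theorem exists_eigenvector_of_unipotent_normal [Nontrivial V] {G : Type*} [Group G]
    (U : Subgroup G) [U.Normal] (hU : ∀ a b : G ⧸ U, a * b = b * a)
    (ρ : G →* Module.End K V) (hρ : ∀ g ∈ U, IsNilpotent (ρ g - 1)) :
    ∃ v : V, v ≠ 0 ∧ ∀ g, ∃ c : K, ρ g v = c • v := by
  -- The fixed space of U is nonzero by Kolchin's theorem and stable under G by normality. On it G
  -- acts through the abelian quotient by U.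
  let F : Submodule K V := ⨅ u : U, LinearMap.ker (ρ u - 1)
  have hF {v : V} : v ∈ F ↔ ∀ u ∈ U, ρ u v = v := by
    simp [F, Submodule.mem_iInf, sub_eq_zero]
  have hstab (g : G) (v : V) (hv : v ∈ F) : ρ g v ∈ F := by
    rw [hF] at hv ⊢
    intro u hu
    have h1 : u * g = g * (g⁻¹ * u * g) := by group
    rw [← Module.End.mul_apply, ← map_mul, h1, map_mul, Module.End.mul_apply, hv]
    simpa using ‹U.Normal›.conj_mem u hu g⁻¹
  have : Nontrivial F := by
    obtain ⟨v, hv, h⟩ := exists_fixed_of_isNilpotent_sub_one (ρ.comp U.subtype) fun g ↦ hρ g g.2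
    exact ⟨⟨v, hF.mpr fun u hu ↦ h ⟨u, hu⟩⟩, 0, by simpa using hv⟩
  let σ : G →* Module.End K F :=
    { toFun := fun g ↦ (ρ g).restrict (hstab g)
      map_one' := by ext; simp
      map_mul' := fun g h ↦ by ext; simp }
  obtain ⟨v, hv, h⟩ := exists_eigenvector_of_commute σ fun g h ↦ by
    ext v
    change ρ g (ρ h v) = ρ h (ρ g v)
    rw [← Module.End.mul_apply, ← map_mul, ← Module.End.mul_apply, ← map_mul]
    have hu : (h * g)⁻¹ * (g * h) ∈ U := QuotientGroup.eq.mp (hU h g)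
    rw [← mul_inv_cancel_left (h * g) (g * h), map_mul, Module.End.mul_apply, hF.mp v.2 _ hu]
  refine ⟨v, by simpa using hv, fun g ↦ ?_⟩
  obtain ⟨c, hc⟩ := h g
  exact ⟨c, congrArg Subtype.val hc⟩

end LinearAlgebra
/-! ### Representations with regular matrix entries -/

section Triangular

open Matrix

variable {K : Type*} [Field K]

lemma exists_mulVec_single_last {n : ℕ} {v : Fin (n + 1) → K} (hv : v ≠ 0) :
    ∃ Q : GL (Fin (n + 1)) K, (Q : Matrix _ _ K) *ᵥ Pi.single (Fin.last n) 1 = v := by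
  obtain ⟨k, hk⟩ := Function.ne_iff.mp hv
  -- The identity with column k replaced by v has determinant v k, which is nonzero. The swap moves
  -- v to the last column.
  let M := ((1 : Matrix (Fin (n + 1)) (Fin (n + 1)) K).updateCol k v).submatrix id
    (Equiv.swap k (Fin.last n))
  have hdet : M.det ≠ 0 := by
    rw [det_permute', ← cramer_apply, cramer_one]
    refine mul_ne_zero ?_ (by simpa using hk)
    rcases Int.units_eq_one_or (Equiv.Perm.sign (Equiv.swap k (Fin.last n))) with h | h <;>
      simp [h]
  refine ⟨GeneralLinearGroup.mkOfDetNeZero M hdet, ?_⟩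
  change M *ᵥ _ = v
  ext i
  simp [M]

/-- If every representation with matrix entries in `R` has an eigenvector, then every
representation with matrix entries in `R` is triangular in a suitable basis. -/
theorem exists_conj_triangular {G : Type*} [Group G] (R : Subring (G → K))
    (hR : ∀ c : K, (fun _ ↦ c) ∈ R)
    (h : ∀ (n : ℕ) (ρ : G →* GL (Fin n) K), 0 < n →
      (∀ i j, (fun g ↦ (ρ g : Matrix (Fin n) (Fin n) K) i j) ∈ R) →
      ∃ v : Fin n → K, v ≠ 0 ∧ ∀ g, ∃ c : K, (ρ g : Matrix (Fin n) (Fin n) K) *ᵥ v = c • v)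
    (n : ℕ) (ρ : G →* GL (Fin n) K)
    (hρ : ∀ i j, (fun g ↦ (ρ g : Matrix (Fin n) (Fin n) K) i j) ∈ R) :
    ∃ P P' : Matrix (Fin n) (Fin n) K, P * P' = 1 ∧ ∀ g i j, i < j → (P * ρ g * P') i j = 0 := by
  induction n with
  | zero => exact ⟨1, 1, by simp, fun g i ↦ i.elim0⟩
  | succ n ih =>
    obtain ⟨v, hv, hev⟩ := h _ ρ n.succ_pos hρ
    obtain ⟨Q, hQ⟩ := exists_mulVec_single_last hv
    let e : Fin n ⊕ Fin 1 ≃ Fin (n + 1) := finSumFinEquiv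
    let ρ' : G →* Matrix (Fin n ⊕ Fin 1) (Fin n ⊕ Fin 1) K :=
      ((reindexAlgEquiv K K e.symm : _ →* _)).comp
        ((Units.coeHom _).comp ((MulAut.conj Q⁻¹).toMonoidHom.comp ρ))
    have hρ' (g : G) : ρ' g = ((Q⁻¹ * ρ g * Q : GL _ K) : Matrix _ _ K).submatrix e e := by
      simp [ρ']
    have hblock (g : G) : (ρ' g).toBlocks₁₂ = 0 := by
      obtain ⟨c, hc⟩ := hev g
      have h1 : ((Q⁻¹ * ρ g * Q : GL _ K) : Matrix _ _ K) *ᵥ Pi.single (Fin.last n) 1 =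
          c • Pi.single (Fin.last n) 1 := by
        rw [Units.val_mul, Units.val_mul, ← mulVec_mulVec, hQ, ← mulVec_mulVec, hc,
          mulVec_smul, ← hQ, mulVec_mulVec, ← Units.val_mul, inv_mul_cancel, Units.val_one,
          one_mulVec]
      ext i j
      have h2 := congrFun h1 i.castSucc
      rw [mulVec_single_one] at h2
      have hj : e (Sum.inr j) = Fin.last n := by
        rw [Subsingleton.elim j 0]; rfl
      have hi : e (Sum.inl i) = i.castSucc := rfl
      rw [hρ', toBlocks₁₂, of_apply, submatrix_apply, hi, hj]
      simpa [Fin.castSucc_ne_last] using h2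
    -- With the eigenvector last, the upper right block is zero, so the upper left block is
    -- multiplicative: it is the representation on the quotient by the eigenline. The induction
    -- hypothesis applies to it.
    let σ₀ : G →* Matrix (Fin n) (Fin n) K :=
      { toFun := fun g ↦ (ρ' g).toBlocks₁₁
        map_one' := by rw [map_one, ← fromBlocks_one, toBlocks_fromBlocks₁₁]
        map_mul' := fun g g' ↦ by
          rw [map_mul, ← fromBlocks_toBlocks (ρ' g), ← fromBlocks_toBlocks (ρ' g'),
            fromBlocks_multiply, toBlocks_fromBlocks₁₁, hblock]
          simp }
    obtain ⟨P, P', hP, htri⟩ := ih σ₀.toHomUnits fun i j ↦ by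
      have : (fun g ↦ (σ₀.toHomUnits g : Matrix (Fin n) (Fin n) K) i j) =
          ∑ k, ∑ l, (fun _ ↦ (Q⁻¹ : GL _ K) i.castSucc k * Q l j.castSucc) *
            fun g ↦ (ρ g : Matrix (Fin (n + 1)) (Fin (n + 1)) K) k l := by
        ext g
        have h1 : (σ₀.toHomUnits g : Matrix (Fin n) (Fin n) K) i j =
            ((Q⁻¹ * ρ g * Q : GL _ K) : Matrix _ _ K) i.castSucc j.castSucc := by
          change (ρ' g) (Sum.inl i) (Sum.inl j) = _
          rw [hρ']; rfl
        rw [h1, Units.val_mul, Units.val_mul, mul_apply]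
        simp only [mul_apply, Finset.sum_mul, Finset.sum_apply, Pi.mul_apply]
        rw [Finset.sum_comm]
        refine Finset.sum_congr rfl fun k _ ↦ Finset.sum_congr rfl fun l _ ↦ by ring
      rw [this]
      exact sum_mem fun k _ ↦ sum_mem fun l _ ↦ mul_mem (hR _) (hρ k l)
    let B := fromBlocks P 0 0 (1 : Matrix (Fin 1) (Fin 1) K)
    let B' := fromBlocks P' 0 0 (1 : Matrix (Fin 1) (Fin 1) K)
    have hB : B * B' = 1 := by simp [B, B', fromBlocks_multiply, hP]
    refine ⟨B.submatrix e.symm e.symm * (Q⁻¹ : GL _ K), Q * B'.submatrix e.symm e.symm, ?_, ?_⟩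
    · rw [Matrix.mul_assoc, ← Matrix.mul_assoc (Q⁻¹).val Q.val, ← Units.val_mul,
        inv_mul_cancel, Units.val_one, Matrix.one_mul, submatrix_mul_equiv, hB, submatrix_one_equiv]
    · intro g i j hij
      have h1 : B.submatrix e.symm e.symm * (Q⁻¹ : GL _ K) * ρ g *
          (Q * B'.submatrix e.symm e.symm) = (B * ρ' g * B').submatrix e.symm e.symm := by
        rw [← submatrix_mul_equiv _ _ _ e.symm, ← submatrix_mul_equiv _ _ _ e.symm, hρ',
          submatrix_submatrix]
        simp [Matrix.mul_assoc]
      rw [h1, ← fromBlocks_toBlocks (ρ' g), hblock, fromBlocks_multiply, fromBlocks_multiply,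
        submatrix_apply]
      obtain ⟨i, rfl⟩ := e.surjective i
      obtain ⟨j, rfl⟩ := e.surjective j
      rw [e.symm_apply_apply, e.symm_apply_apply]
      rcases i with i | i <;> rcases j with j | j
      · simpa using! (show (P * (ρ' g).toBlocks₁₁ * P') i j = 0 from htri g i j hij)
      · simp
      · exfalso
        have := Fin.le_last (e (Sum.inl j))
        rw [Subsingleton.elim i 0] at hij
        exact (this.trans_lt' hij).ne rfl
      · exact absurd hij (by rw [Subsingleton.elim i j]; exact lt_irrefl _)

end Triangular

/-! ### Regular functions on `K`-points and triangular representations -/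

section Regular

variable {K : Type u} [Field K]

/-- The constants in the ring of global functions. -/
noncomputable def constHom (X : Over (Spec (.of K))) : K →+* Γ(X.left, ⊤) :=
  X.hom.appTop.hom.comp (Scheme.ΓSpecIso (.of K)).inv.hom

lemma evalAt_constHom {X : Over (Spec (.of K))} (x : 𝟙_ (Over (Spec (.of K))) ⟶ X) (c : K) :
    evalAt x (constHom X c) = c := by
  have h : (Scheme.ΓSpecIso (.of K)).inv ≫ X.hom.appTop ≫ x.left.appTop ≫
      (Scheme.ΓSpecIso (.of K)).hom = 𝟙 _ := by
    rw [← Scheme.Hom.comp_appTop_assoc, Over.w x]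
    exact Iso.inv_hom_id _
  exact congr($(h) c)

/-- The regular functions on the group of `K`-points. -/
noncomputable def regularFunctions (X : Over (Spec (.of K))) :
    Subring ((𝟙_ (Over (Spec (.of K))) ⟶ X) → K) :=
  (RingHom.pi fun x ↦ evalAt x).range

lemma mem_regularFunctions_iff {X : Over (Spec (.of K))}
    {f : (𝟙_ (Over (Spec (.of K))) ⟶ X) → K} :
    f ∈ regularFunctions X ↔ ∃ a : Γ(X.left, ⊤), ∀ x, f x = evalAt x a :=
  ⟨fun ⟨a, ha⟩ ↦ ⟨a, fun x ↦ congrFun ha.symm x⟩, fun ⟨a, ha⟩ ↦ ⟨a, funext fun x ↦ (ha x).symm⟩⟩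

/-- Every representation is triangular in a suitable basis. -/
theorem RepsHaveEigenvectors.exists_conj_triangular {H : Over (Spec (.of K))} [GrpObj H]
    (hH : RepsHaveEigenvectors H) {n : ℕ}
    {ρ : (𝟙_ (Over (Spec (.of K))) ⟶ H) →* GL (Fin n) K} (hρ : IsRep ρ) :
    ∃ P P' : Matrix (Fin n) (Fin n) K, P * P' = 1 ∧
      ∀ g i j, i < j → (P * (ρ g : Matrix (Fin n) (Fin n) K) * P') i j = 0 :=
  GoingDown.exists_conj_triangular (regularFunctions H)
    (fun c ↦ mem_regularFunctions_iff.mpr ⟨constHom H c, fun x ↦ (evalAt_constHom x c).symm⟩)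
    (fun n ρ hn hρ ↦ hH n ρ hn fun i j ↦ mem_regularFunctions_iff.mp (hρ i j)) n ρ
    fun i j ↦ mem_regularFunctions_iff.mpr (hρ i j)

theorem IsUnipotentByAbelian.repsHaveEigenvectors [IsAlgClosed K] {H : Over (Spec (.of K))}
    [GrpObj H] (hH : IsUnipotentByAbelian H) : RepsHaveEigenvectors H := by
  obtain ⟨U, _, -, hU, hab⟩ := hH
  intro n ρ hn hρ
  have : Nonempty (Fin n) := ⟨⟨0, hn⟩⟩
  let T : Matrix (Fin n) (Fin n) K ≃ₐ[K] Module.End K (Fin n → K) := Matrix.toLinAlgEquiv'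
  let ρ' : (𝟙_ (Over (Spec (.of K))) ⟶ H) →* Module.End K (Fin n → K) :=
    (T : _ →* _).comp ((Units.coeHom _).comp ρ)
  obtain ⟨v, hv, h⟩ := exists_eigenvector_of_unipotent_normal U hab ρ' fun g hg ↦ by
    have := (hU g hg n ρ hρ).map T
    rwa [map_sub, map_one] at this
  exact ⟨v, hv, fun g ↦ h g⟩

end Regular
/-! ### Spectra of algebras and charts at smooth points -/

section Spec

variable {K : Type u} [Field K]

/-- The spectrum of a `K`-algebra as a `K`-scheme. -/
noncomputable def spec (K : Type u) [Field K] (A : Type u) [CommRing A] [Algebra K A] :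
    Over (Spec (.of K)) :=
  Over.mk (Spec.map (CommRingCat.ofHom (algebraMap K A)))

variable {A B C : Type u} [CommRing A] [Algebra K A] [CommRing B] [Algebra K B] [CommRing C]
  [Algebra K C]

/-- The morphism of spectra defined by a homomorphism of `K`-algebras. -/
noncomputable def specMap (f : A →ₐ[K] B) : spec K B ⟶ spec K A :=
  Over.homMk (Spec.map (CommRingCat.ofHom f.toRingHom)) (by
    change Spec.map _ ≫ Spec.map _ = Spec.map _
    rw [← Spec.map_comp, ← CommRingCat.ofHom_comp]
    congr 2
    exact f.comp_algebraMap)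

lemma specMap_left (f : A →ₐ[K] B) :
    (specMap f).left = Spec.map (CommRingCat.ofHom f.toRingHom) := rfl

lemma specMap_comp (f : A →ₐ[K] B) (g : B →ₐ[K] C) :
    specMap (g.comp f) = specMap g ≫ specMap f := by
  ext1
  exact Spec.map_comp (CommRingCat.ofHom f.toRingHom) (CommRingCat.ofHom g.toRingHom)

lemma specMap_injective : Function.Injective (specMap : (A →ₐ[K] B) → _) := by
  intro f g h
  have := Spec.map_injective (congrArg CommaMorphism.left h)
  exact AlgHom.ext fun a ↦ congr($this a)

lemma specMap_surjective : Function.Surjective (specMap : (A →ₐ[K] B) → _) := by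
  intro t
  obtain ⟨φ, hφ⟩ := Spec.map_surjective t.left
  have h : CommRingCat.ofHom (algebraMap K A) ≫ φ = CommRingCat.ofHom (algebraMap K B) := by
    apply Spec.map_injective
    rw [Spec.map_comp, hφ]
    exact Over.w t
  have h' (c : K) : φ.hom (algebraMap K A c) = algebraMap K B c :=
    RingHom.congr_fun (congrArg CommRingCat.Hom.hom h) c
  refine ⟨{ φ.hom with commutes' := h' }, ?_⟩
  ext1
  rw [specMap_left, ← hφ]
  congr 1

lemma spec_self_hom : (spec K K).hom = 𝟙 (Spec (.of K)) := by
  have h : CommRingCat.ofHom (algebraMap K K) = 𝟙 (CommRingCat.of K) := by ext; rfl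
  exact (congrArg Spec.map h).trans (Spec.map_id _)

/-- The `K`-point of `spec K K`. -/
noncomputable def unitToSpec (K : Type u) [Field K] : 𝟙_ (Over (Spec (.of K))) ⟶ spec K K :=
  Over.homMk (𝟙 (Spec (.of K))) (by
    rw [spec_self_hom]
    exact Category.comp_id (𝟙 (Spec (.of K))))

/-- Morphisms from a spectrum factor through an open immersion if they do so topologically. -/
lemma exists_specMap_comp_eq {X : Over (Spec (.of K))} (j : spec K A ⟶ X) [IsOpenImmersion j.left]
    (t : spec K B ⟶ X) (ht : Set.range t.left ⊆ Set.range j.left) :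
    ∃ φ : A →ₐ[K] B, specMap φ ≫ j = t := by
  let s : spec K B ⟶ spec K A := Over.homMk (IsOpenImmersion.lift j.left t.left ht) (by
    rw [← Over.w j, IsOpenImmersion.lift_fac_assoc, Over.w t])
  obtain ⟨φ, hφ⟩ := specMap_surjective s
  refine ⟨φ, ?_⟩
  rw [hφ]
  ext1
  exact IsOpenImmersion.lift_fac _ _ _

lemma specMap_comp_injective {X : Over (Spec (.of K))} (j : spec K A ⟶ X)
    [IsOpenImmersion j.left] {φ φ' : A →ₐ[K] B} (h : specMap φ ≫ j = specMap φ' ≫ j) :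
    φ = φ' := by
  apply specMap_injective
  ext1
  rw [← cancel_mono j.left]
  exact congrArg CommaMorphism.left h

lemma exists_affine_chart {X : Over (Spec (.of K))} {x : 𝟙_ (Over (Spec (.of K))) ⟶ X}
    (hx : IsSmoothPoint x) :
    ∃ (A : Type u) (_ : CommRing A) (_ : Algebra K A) (j : spec K A ⟶ X),
      Algebra.IsStandardSmooth K A ∧ IsOpenImmersion j.left ∧
      Set.range x.left ⊆ Set.range j.left := by
  obtain ⟨V, hxV, hV⟩ := hx
  let x₀ : X.left := x.left (IsLocalRing.closedPoint K)
  have hrange (a) : x.left a = x₀ := by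
    congr 1
    exact Subsingleton.elim (α := PrimeSpectrum K) _ _
  obtain ⟨R, f, hf, ⟨q, hq⟩, hfV⟩ :=
    Scheme.exists_affine_mem_range_and_range_subset (U := V) (x := x₀) (hxV ⟨_, rfl⟩)
  obtain ⟨φ, hφ⟩ := Spec.map_surjective (f ≫ X.hom)
  have hsm : Smooth (Spec.map φ) := by
    rw [hφ, ← IsOpenImmersion.lift_fac V.ι f (by rwa [Scheme.Opens.range_ι]), Category.assoc]
    infer_instance
  let : Algebra K R := φ.hom.toAlgebra
  have : Algebra.Smooth K R := (HasRingHomProperty.Spec_iff (P := @Smooth)).mp hsm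
  have hqp : (PrimeSpectrum.asIdeal (R := R) q).IsPrime := PrimeSpectrum.isPrime (R := R) q
  obtain ⟨g, hgq, hg⟩ := Algebra.IsSmoothAt.exists_notMem_isStandardSmooth K
    (PrimeSpectrum.asIdeal (R := R) q)
  let l : Spec (.of (Localization.Away g)) ⟶ Spec R :=
    Spec.map (CommRingCat.ofHom (algebraMap R (Localization.Away g)))
  have hl : IsOpenImmersion l := by
    dsimp only [l]
    infer_instance
  have hlf : IsOpenImmersion (l ≫ f) := inferInstance
  have hw : (l ≫ f) ≫ X.hom =
      Spec.map (CommRingCat.ofHom (algebraMap K (Localization.Away g))) := by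
    rw [Category.assoc, ← hφ]
    exact (Spec.map_comp φ (CommRingCat.ofHom (algebraMap R (Localization.Away g)))).symm
  refine ⟨Localization.Away g, inferInstance, inferInstance, Over.homMk (l ≫ f) hw, hg, hlf, ?_⟩
  · rintro _ ⟨a, rfl⟩
    have hq' : q ∈ Set.range (PrimeSpectrum.comap (algebraMap R (Localization.Away g))) := by
      rw [PrimeSpectrum.localization_away_comap_range _ g]
      exact hgq
    obtain ⟨q', rfl⟩ := hq'
    exact ⟨q', hq.trans (hrange a).symm⟩

/-- A standard smooth algebra is étale over a polynomial ring. A translation of the coordinates then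
puts the point over the origin. -/
theorem exists_etale_chart {X : Over (Spec (.of K))} {x : 𝟙_ (Over (Spec (.of K))) ⟶ X}
    (hx : IsSmoothPoint x) :
    ∃ (d : ℕ) (A : Type u) (_ : CommRing A) (_ : Algebra K A)
      (e : MvPolynomial (Fin d) K →ₐ[K] A) (ε : A →ₐ[K] K) (j : spec K A ⟶ X),
      e.toRingHom.Etale ∧ (∀ i, ε (e (.X i)) = 0) ∧ IsOpenImmersion j.left ∧
      specMap ε ≫ j = toUnit _ ≫ x := by
  obtain ⟨A, _, _, j, hA, hj, hxj⟩ := exists_affine_chart hx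
  obtain ⟨d, g, hg, hge⟩ := RingHom.IsStandardSmooth.exists_etale_mvPolynomial
    (f := algebraMap K A) (RingHom.isStandardSmooth_algebraMap.mpr hA)
  let e : MvPolynomial (Fin d) K →ₐ[K] A := { g with commutes' := fun c ↦ congr($hg c) }
  obtain ⟨ε, hε⟩ := exists_specMap_comp_eq j (toUnit (spec K K) ≫ x)
    (by
      rintro _ ⟨a, rfl⟩
      rw [Over.comp_left, Scheme.Hom.comp_apply]
      exact hxj ⟨_, rfl⟩)
  let c (i : Fin d) : K := ε (e (.X i))
  let σ (c : Fin d → K) : MvPolynomial (Fin d) K →ₐ[K] MvPolynomial (Fin d) K :=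
    MvPolynomial.aeval fun i ↦ .X i + .C (c i)
  have hσ (c : Fin d → K) : (σ c).comp (σ (-c)) = AlgHom.id K _ :=
    MvPolynomial.algHom_ext fun i ↦ by simp [σ]
  let τ : MvPolynomial (Fin d) K ≃ₐ[K] MvPolynomial (Fin d) K :=
    AlgEquiv.ofAlgHom (σ (-c)) (σ c) (by simpa using hσ (-c)) (hσ c)
  refine ⟨d, A, _, _, e.comp τ.toAlgHom, ε, j, ?_, fun i ↦ ?_, hj, hε⟩
  · exact RingHom.Etale.respectsIso.2 g τ.toRingEquiv hge
  · simp [τ, σ, c]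

end Spec
/-! ### Linear terms of power series and homomorphisms from étale algebras to power series -/

section PowerSeries

open MvPowerSeries Finsupp

variable {K R : Type*} [Field K] [CommRing R] [Algebra K R] {d : ℕ}

/-- Each nonconstant monomial is divided by one variable chosen among those it contains. Being the
ideal of the variables, the kernel of the constant term is accessible to adic arguments. -/
lemma mem_span_range_X {f : MvPowerSeries (Fin d) R} (hf : constantCoeff f = 0) :
    f ∈ Ideal.span (Set.range (X : Fin d → MvPowerSeries (Fin d) R)) := by
  classical
  have hne (n : Fin d →₀ ℕ) : n = 0 ∨ ∃ i, n i ≠ 0 := by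
    by_cases h : n = 0
    · exact .inl h
    · exact .inr (Finsupp.ne_iff.mp h)
  choose c hc using fun n : {n : Fin d →₀ ℕ // n ≠ 0} ↦ Finsupp.ne_iff.mp n.2
  let g (i : Fin d) : MvPowerSeries (Fin d) R := fun n ↦
    if h : n + single i 1 ≠ 0 then if c ⟨_, h⟩ = i then coeff (n + single i 1) f else 0 else 0
  rw [Ideal.mem_span_range_iff_exists_fun]
  refine ⟨g, ?_⟩
  ext n
  simp only [map_sum, X, mul_comm, coeff_monomial_mul, one_mul]
  by_cases hn : n = 0
  · subst hn
    rw [coeff_zero_eq_constantCoeff_apply, hf]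
    exact Finset.sum_eq_zero fun i _ ↦ if_neg (by simp)
  · have hle (i : Fin d) (h : single i 1 ≤ n) : coeff (n - single i 1) (g i) =
        if c ⟨n, hn⟩ = i then coeff n f else 0 := by
      have := tsub_add_cancel_of_le h
      change (if h : n - single i 1 + single i 1 ≠ 0 then _ else 0) = _
      simp only [this]
      rw [dif_pos hn]
    rw [Finset.sum_eq_single (c ⟨n, hn⟩)]
    · have h : single (c ⟨n, hn⟩) 1 ≤ n := by
        have := hc ⟨n, hn⟩
        rw [Finsupp.single_le_iff]
        exact Nat.one_le_iff_ne_zero.mpr this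
      rw [if_pos h, hle _ h, if_pos rfl]
    · intro i _ hi
      split_ifs with h
      · rw [hle i h, if_neg hi.symm]
      · rfl
    · simp

lemma coeff_single_one_mul (p q : MvPowerSeries (Fin d) R) (j : Fin d) :
    coeff (single j 1) (p * q) = constantCoeff p * coeff (single j 1) q +
      coeff (single j 1) p * constantCoeff q := by
  classical
  rw [coeff_mul, Finsupp.antidiagonal_single]
  simp [Finset.Nat.antidiagonal_succ]

lemma constantCoeff_subst_of_constantCoeff_eq_zero {a : Fin d → MvPowerSeries (Fin d) R}
    (ha : ∀ i, constantCoeff (a i) = 0) (f : MvPowerSeries (Fin d) R) :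
    constantCoeff (subst a f) = constantCoeff f := by
  have hs := hasSubst_of_constantCoeff_zero ha
  have h := constantCoeff_subst_eq_zero hs ha (f := f - C (constantCoeff f)) (by simp)
  rw [subst_sub hs, subst_C, map_sub, sub_eq_zero] at h
  simpa using h

/-- The chain rule at the origin: linear parts compose as matrices. This makes the action on linear
terms a representation. -/
lemma coeff_single_one_subst {a : Fin d → MvPowerSeries (Fin d) R}
    (ha : ∀ i, constantCoeff (a i) = 0) (f : MvPowerSeries (Fin d) R) (j : Fin d) :
    coeff (single j 1) (subst a f) =
      ∑ k, coeff (single k 1) f * coeff (single j 1) (a k) := by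
  classical
  have hs := hasSubst_of_constantCoeff_zero ha
  obtain ⟨g, hg⟩ := (Ideal.mem_span_range_iff_exists_fun).mp
    (mem_span_range_X (f := f - C (constantCoeff f)) (by simp))
  have hf : f = C (constantCoeff f) + ∑ i, g i * X i := by rw [hg]; ring
  have hcoeff (k : Fin d) : coeff (single k 1) f = constantCoeff (g k) := by
    rw [hf, map_add, map_sum]
    simp only [coeff_single_one_mul, coeff_C, constantCoeff_X, mul_zero, add_zero, coeff_X,
      Finsupp.single_eq_zero, one_ne_zero, if_false, zero_add]
    rw [Finset.sum_eq_single k]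
    · simp
    · intro i _ hi
      rw [if_neg, mul_zero]
      simpa [Finsupp.single_left_inj] using hi.symm
    · simp
  rw [hf, ← coe_substAlgHom hs, map_add, map_sum, map_add, map_sum]
  simp only [map_mul, coe_substAlgHom, subst_C, subst_X hs, coeff_single_one_mul, ha, mul_zero,
    add_zero, coeff_C, Finsupp.single_eq_zero, one_ne_zero, if_false, zero_add,
    constantCoeff_subst_of_constantCoeff_eq_zero ha, ← hcoeff]
  rw [← hf]

/-- Among exponents of degree one the order reverses the indices, so the linear exponents below that
of X_i belong to the X_j with i < j. -/
lemma degLexOrder_eq_single {p : MvPowerSeries (Fin d) K} (i : Fin d)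
    (h0 : constantCoeff p = 0) (hi : coeff (single i 1) p ≠ 0)
    (hlt : ∀ j, i < j → coeff (single j 1) p = 0) :
    degLexOrder p = WithTop.some (toDegLex (single i 1)) := by
  rw [degLexOrder_eq_coe_iff]
  refine ⟨hi, fun b hb ↦ ?_⟩
  rw [DegLex.lt_iff] at hb
  simp only [ofDegLex_toDegLex, degree_single] at hb
  rcases hb with hb | ⟨hb, hlex⟩
  · have : b = 0 := (degree_eq_zero_iff b).mp (Nat.lt_one_iff.mp hb)
    rw [this, coeff_zero_eq_constantCoeff_apply, h0]
  · obtain ⟨j, rfl⟩ : ∃ j, b = single j 1 := by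
      obtain ⟨j, hj⟩ : ∃ j, b j ≠ 0 := by
        by_contra! h
        rw [show b = 0 from Finsupp.ext h] at hb
        simp at hb
      have hj' : single j 1 ≤ b := Finsupp.single_le_iff.mpr (Nat.one_le_iff_ne_zero.mpr hj)
      have h := congrArg degree (tsub_add_cancel_of_le hj')
      rw [map_add, hb, degree_single, Nat.add_eq_right, degree_eq_zero_iff] at h
      exact ⟨j, le_antisymm (tsub_eq_zero_iff_le.mp h) hj'⟩
    exact hlt j (DegLex.single_lt_iff.mp (DegLex.lt_iff.mpr (.inr ⟨by simp, hlex⟩)))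

/-- A homomorphism from an algebra unramified over a polynomial ring to a ring of power series is
determined by the coordinates and the constant terms. -/
lemma algHom_ext_of_formallyUnramified {A : Type*} [CommRing A] [Algebra K A]
    {e : MvPolynomial (Fin d) K →ₐ[K] A} (he : e.toRingHom.FormallyUnramified)
    {φ φ' : A →ₐ[K] MvPowerSeries (Fin d) R} (h : ∀ i, φ (e (.X i)) = φ' (e (.X i)))
    (h' : ∀ a, constantCoeff (φ a) = constantCoeff (φ' a)) : φ = φ' := by
  algebraize [e.toRingHom]
  let : Algebra (MvPolynomial (Fin d) K) (MvPowerSeries (Fin d) R) := (φ.comp e).toRingHom.toAlgebra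
  have hφ : φ.comp e = φ'.comp e := MvPolynomial.algHom_ext h
  let g : A →ₐ[MvPolynomial (Fin d) K] MvPowerSeries (Fin d) R :=
    { φ with commutes' := fun _ ↦ rfl }
  let g' : A →ₐ[MvPolynomial (Fin d) K] MvPowerSeries (Fin d) R :=
    { φ' with commutes' := fun p ↦ (AlgHom.congr_fun hφ p).symm }
  have hgg : g = g' := by
    refine Algebra.FormallyUnramified.ext_of_iInf
      (I := Ideal.span (Set.range (X : Fin d → MvPowerSeries (Fin d) R))) ?_ fun a ↦ ?_
    · have h : IsHausdorff (.span (.range X) : Ideal (MvPowerSeries (Fin d) R))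
        (MvPowerSeries (Fin d) R) := inferInstance
      have := h.iInf_pow_smul
      simp only [smul_eq_mul, Ideal.mul_top] at this
      exact this
    · rw [Ideal.Quotient.eq]
      exact mem_span_range_X (by rw [map_sub, sub_eq_zero]; exact h' a)
  exact AlgHom.ext fun a ↦ congr($hgg a)

/-- Taylor expansion at the point: ε is a homomorphism modulo the ideal of the variables, and it
lifts because power series are complete for that ideal. -/
lemma exists_algHom_of_formallySmooth {A : Type*} [CommRing A] [Algebra K A]
    {e : MvPolynomial (Fin d) K →ₐ[K] A} (he : e.toRingHom.FormallySmooth) (ε : A →ₐ[K] K)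
    (hε : ∀ i, ε (e (.X i)) = 0) :
    ∃ φ : A →ₐ[K] MvPowerSeries (Fin d) K, (∀ i, φ (e (.X i)) = X i) ∧
      ∀ a, constantCoeff (φ a) = ε a := by
  algebraize [e.toRingHom]
  let I := Ideal.span (Set.range (X : Fin d → MvPowerSeries (Fin d) K))
  let f : A →ₐ[MvPolynomial (Fin d) K] MvPowerSeries (Fin d) K ⧸ I :=
    { (algebraMap K _).comp ε.toRingHom with
      commutes' := fun p ↦ by
        refine Ideal.Quotient.eq.mpr
          (mem_span_range_X (f := C (ε (e p)) - (p : MvPowerSeries (Fin d) K)) ?_)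
        have : ε.comp e = MvPolynomial.aeval 0 := MvPolynomial.algHom_ext fun i ↦ by simp [hε]
        have h : ε (e p) = constantCoeff (p : MvPowerSeries (Fin d) K) := by
          rw [← AlgHom.comp_apply, this, MvPolynomial.aeval_zero,
            ← coeff_zero_eq_constantCoeff_apply, MvPolynomial.coeff_coe]
          rfl
        rw [map_sub, constantCoeff_C, h, sub_self] }
  obtain ⟨φ, hφ⟩ := Algebra.FormallySmooth.exists_mkₐ_comp_eq_of_isAdicComplete f
  refine ⟨φ.restrictScalars K, fun i ↦ ?_, fun a ↦ ?_⟩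
  · exact (φ.commutes (.X i)).trans (MvPolynomial.coe_X i)
  · have h : Ideal.Quotient.mk I (φ a) = Ideal.Quotient.mk I (C (ε a)) := congr($hφ a)
    have hI : I ≤ RingHom.ker (constantCoeff (σ := Fin d) (R := K)) := by
      rw [Ideal.span_le]
      rintro _ ⟨i, rfl⟩
      simp
    have h' := hI (Ideal.Quotient.eq.mp h)
    rw [RingHom.mem_ker, map_sub, sub_eq_zero, constantCoeff_C] at h'
    exact h'

end PowerSeries
/-! ### The action of the group on formal germs at a fixed point -/

section Germs

variable {K : Type u} [Field K]

lemma specMap_isoSpec_inv (Z : Scheme.{u}) [IsAffine Z] (R : CommRingCat.{u}) (f : Spec R ⟶ Z) :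
    Spec.map (f.appTop ≫ (Scheme.ΓSpecIso R).hom) ≫ Z.isoSpec.inv = f := by
  rw [Spec.map_comp, Category.assoc, Scheme.isoSpec_inv_naturality, Scheme.isoSpec_Spec_inv,
    ← Category.assoc, ← Spec.map_comp, Iso.inv_hom_id, Spec.map_id, Category.id_comp]

/-- The universal point of an affine scheme, from which every `K`-point is obtained by evaluation. -/
lemma exists_universal_point (H : Over (Spec (.of K))) [IsAffine H.left] :
    ∃ (B : Type u) (_ : CommRing B) (_ : Algebra K B) (u : spec K B ⟶ H)
      (θ : B →+* Γ(H.left, ⊤)), ∀ g : 𝟙_ (Over (Spec (.of K))) ⟶ H, ∃ ev : B →ₐ[K] K,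
        (∀ b, ev b = evalAt g (θ b)) ∧ specMap ev ≫ u = toUnit _ ≫ g := by
  let : Algebra K Γ(H.left, ⊤) := (constHom H).toAlgebra
  have hu : H.left.isoSpec.inv ≫ H.hom = (spec K Γ(H.left, ⊤)).hom := by
    rw [← Scheme.isoSpec_inv_naturality, Scheme.isoSpec_Spec_inv, ← Spec.map_comp]
    rfl
  refine ⟨Γ(H.left, ⊤), inferInstance, inferInstance, Over.homMk H.left.isoSpec.inv hu,
    RingHom.id _, fun g ↦ ?_⟩
  refine ⟨{ evalAt g with commutes' := evalAt_constHom g }, fun b ↦ rfl, ?_⟩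
  ext1
  have h : (toUnit (spec K K)).left = (spec K K).hom := by simp
  have h' : (toUnit (spec K K) ≫ g).left = g.left := by
    rw [Over.comp_left, h, spec_self_hom]
    exact Category.id_comp _
  rw [h']
  exact specMap_isoSpec_inv H.left (.of K) g.left

open MvPowerSeries

variable {S : Type u} [CommRing S] [Algebra K S] {d : ℕ}

/-- A series with invertible constant term is a unit, so every maximal ideal contains the kernel of
the constant term. Hence an open set containing Spec S contains all of Spec S[[X]]. -/
lemma exists_specializes_comap_constantCoeff (p : PrimeSpectrum (MvPowerSeries (Fin d) S)) :
    ∃ q : PrimeSpectrum S, p ⤳ q.comap (constantCoeff (σ := Fin d) (R := S)) := by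
  obtain ⟨m, hm, hpm⟩ := p.asIdeal.exists_le_maximal p.isPrime.ne_top
  have hker : RingHom.ker (constantCoeff (σ := Fin d) (R := S)) ≤ m := by
    intro f hf
    by_contra hfm
    obtain ⟨y, i, hi, hy⟩ := hm.exists_inv hfm
    refine hm.ne_top (Ideal.eq_top_of_isUnit_mem _ hi (isUnit_iff_constantCoeff.mpr ?_))
    rw [eq_sub_of_add_eq' hy, map_sub, map_mul, (RingHom.mem_ker.mp hf), mul_zero, sub_zero,
      map_one]
    exact isUnit_one
  have h : (⟨m, hm.isPrime⟩ : PrimeSpectrum _) ∈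
      Set.range (PrimeSpectrum.comap (constantCoeff (σ := Fin d) (R := S))) := by
    rw [range_comap_of_surjective _ _
      fun s ↦ ⟨C s, constantCoeff_C s⟩]
    exact hker
  obtain ⟨q, hq⟩ := h
  refine ⟨q, (PrimeSpectrum.le_iff_specializes _ _).mp ?_⟩
  rw [hq]
  exact hpm

/-- The constant term of a power series, as a homomorphism of algebras over the base field. -/
noncomputable def constantCoeffHom (K S : Type*) [Field K] [CommRing S] [Algebra K S] (d : ℕ) :
    MvPowerSeries (Fin d) S →ₐ[K] S where
  __ := constantCoeff
  commutes' c := by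
    change constantCoeff (algebraMap K (MvPowerSeries (Fin d) S) c) = _
    rw [MvPowerSeries.algebraMap_apply, constantCoeff_C]

variable {H X : Over (Spec (.of K))} [GrpObj H] [ModObj H X]
  {x : 𝟙_ (Over (Spec (.of K))) ⟶ X} {A : Type u} [CommRing A] [Algebra K A]

/-- The chart need not be stable under `H`. But the translated germ is still centred at the fixed
point, so it sends Spec S into the chart, and then all of Spec S[[X]]. A general S allows the
universal point of `H` as well as its `K`-points. -/
lemma IsFixedPoint.exists_act (hx : IsFixedPoint H x) {j : spec K A ⟶ X} [IsOpenImmersion j.left]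
    {ε : A →ₐ[K] K} (hε : specMap ε ≫ j = toUnit _ ≫ x)
    (h : spec K (MvPowerSeries (Fin d) S) ⟶ H) (φ : A →ₐ[K] MvPowerSeries (Fin d) S)
    (hφ : ∀ a, constantCoeff (φ a) = algebraMap K S (ε a)) :
    ∃ φ' : A →ₐ[K] MvPowerSeries (Fin d) S, specMap φ' ≫ j = h • (specMap φ ≫ j) ∧
      ∀ a, constantCoeff (φ' a) = algebraMap K S (ε a) := by
  have hc : (constantCoeffHom K S d).comp φ = (Algebra.ofId K S).comp ε := AlgHom.ext hφ
  have hx' : specMap ((Algebra.ofId K S).comp ε) ≫ j = toUnit _ ≫ x := by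
    rw [specMap_comp, Category.assoc, hε, ← Category.assoc, toUnit_unique (specMap _ ≫ _)]
  have hcx : specMap (constantCoeffHom K S d) ≫ (h • (specMap φ ≫ j)) =
      specMap ((Algebra.ofId K S).comp ε) ≫ j := by
    rw [ModObj.comp_smul, ← Category.assoc, ← specMap_comp, hc, hx', hx]
  obtain ⟨φ', hφ'⟩ := exists_specMap_comp_eq j (h • (specMap φ ≫ j)) (by
    rintro _ ⟨p, rfl⟩
    obtain ⟨q, hq⟩ := exists_specializes_comap_constantCoeff p
    refine (hq.map (h • (specMap φ ≫ j)).left.continuous).mem_open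
      (Scheme.Hom.isOpenEmbedding j.left).isOpen_range ?_
    refine ⟨(specMap ((Algebra.ofId K S).comp ε)).left q, ?_⟩
    have := congr(($hcx).left q)
    exact this.symm)
  refine ⟨φ', hφ', fun a ↦ ?_⟩
  have : (constantCoeffHom K S d).comp φ' = (Algebra.ofId K S).comp ε :=
    specMap_comp_injective j (by rw [← hcx, specMap_comp, Category.assoc, hφ'])
  exact congr($this a)

end Germs
-- The linearised action at a fixed point and triangular formal coordinates
section TriangularGerms

open MvPowerSeries Finsupp

variable {K : Type u} [Field K] {d : ℕ} {H X : Over (Spec (.of K))} [GrpObj H] [ModObj H X]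
  {x : 𝟙_ (Over (Spec (.of K))) ⟶ X} {A : Type u} [CommRing A] [Algebra K A]

lemma exists_algHom_eq_subst {a : Fin d → MvPowerSeries (Fin d) K}
    (ha : ∀ i, constantCoeff (a i) = 0) :
    ∃ T : MvPowerSeries (Fin d) K →ₐ[K] MvPowerSeries (Fin d) K, ∀ p, T p = subst a p :=
  ⟨(substAlgHom (hasSubst_of_constantCoeff_zero ha)).restrictScalars K, fun p ↦ by simp⟩

/-- The action of the group on formal coordinates at a fixed point. -/
lemma IsFixedPoint.exists_germ_action (hx : IsFixedPoint H x) [IsAffine H.left]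
    {e : MvPolynomial (Fin d) K →ₐ[K] A} (he : e.toRingHom.Etale)
    {ε : A →ₐ[K] K} (he0 : ∀ i, ε (e (.X i)) = 0) {j : spec K A ⟶ X} [IsOpenImmersion j.left]
    (hε : specMap ε ≫ j = toUnit _ ≫ x) :
    ∃ (φ : A →ₐ[K] MvPowerSeries (Fin d) K)
      (Φ : (𝟙_ (Over (Spec (.of K))) ⟶ H) → A →ₐ[K] MvPowerSeries (Fin d) K)
      (ρ : (𝟙_ (Over (Spec (.of K))) ⟶ H) →* GL (Fin d) K),
      (∀ i, φ (e (.X i)) = MvPowerSeries.X i) ∧ (∀ a, constantCoeff (φ a) = ε a) ∧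
      (∀ g a, constantCoeff (Φ g a) = ε a) ∧
      (∀ g, specMap (Φ g) ≫ j = (toUnit (spec K (MvPowerSeries (Fin d) K)) ≫ g) • (specMap φ ≫ j)) ∧
      IsRep ρ ∧ ∀ g i k, (ρ g : Matrix (Fin d) (Fin d) K) i k =
        coeff (single k 1) (Φ g (e (.X i))) := by
  obtain ⟨hunr, hsm⟩ := (RingHom.etale_iff_formallyUnramified_and_smooth _).mp he
  obtain ⟨φ, hφX, hφ⟩ := exists_algHom_of_formallySmooth (e := e) hsm.formallySmooth ε he0
  choose Φ hΦj hΦ using fun g : 𝟙_ (Over (Spec (.of K))) ⟶ H ↦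
    hx.exists_act hε (toUnit _ ≫ g) φ hφ
  have ha (g) (i) : constantCoeff (Φ g (e (.X i))) = 0 := by rw [hΦ, he0]; simp
  have hs (g) : HasSubst fun i ↦ Φ g (e (.X i)) := hasSubst_of_constantCoeff_zero (ha g)
  have hone : Φ 1 = φ := specMap_comp_injective j (by
    rw [hΦj, MonObj.comp_one, one_smul])
  choose T hT using fun h ↦ exists_algHom_eq_subst (ha h)
  -- By étale uniqueness the germ translated by h is φ followed by the substitution T h. Translation
  -- by the constant point g commutes with pullback along T h, which gives the product formula.
  have hmul (g h) : Φ (g * h) = (T h).comp (Φ g) := by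
    have hsub : Φ h = (T h).comp φ :=
      algHom_ext_of_formallyUnramified hunr
        (fun i ↦ by simp [hφX, hT, subst_X (hs h)])
        (fun a ↦ by
          simp [hφ, hΦ, hT, constantCoeff_subst_of_constantCoeff_eq_zero (ha h)])
    apply specMap_comp_injective j
    rw [hΦj, MonObj.comp_mul, mul_smul, ← hΦj, hsub, specMap_comp, specMap_comp, Category.assoc,
      Category.assoc, hΦj, ModObj.comp_smul, ← Category.assoc (specMap _) (toUnit _),
      toUnit_unique (specMap _ ≫ toUnit _) (toUnit _)]
  let ρ₀ : (𝟙_ (Over (Spec (.of K))) ⟶ H) →* Matrix (Fin d) (Fin d) K :=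
    { toFun g := .of fun i k ↦ coeff (single k 1) (Φ g (e (.X i)))
      map_one' := by
        ext i k
        rw [Matrix.of_apply, hone, hφX, coeff_X, Matrix.one_apply]
        simp [Finsupp.single_left_inj, eq_comm]
      map_mul' g h := by
        ext i k
        rw [Matrix.of_apply, hmul, Matrix.mul_apply, AlgHom.comp_apply, hT]
        exact coeff_single_one_subst (ha h) _ _ }
  refine ⟨φ, Φ, ρ₀.toHomUnits, hφX, hφ, hΦ, hΦj, fun i k ↦ ?_, fun g i k ↦ rfl⟩
  -- The matrix entries are regular because the same construction for the universal point of `H` has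
  -- coefficients in B. Evaluation at g recovers Φ g.
  obtain ⟨B, _, _, u, θ, hu⟩ := exists_universal_point H
  let C' : B →ₐ[K] MvPowerSeries (Fin d) B := Algebra.algHom K B _
  let m : MvPowerSeries (Fin d) K →ₐ[K] MvPowerSeries (Fin d) B := mapAlgHom (Algebra.ofId K B)
  obtain ⟨Ψ, hΨj, hΨ⟩ := hx.exists_act hε (specMap C' ≫ u) (m.comp φ) (fun a ↦ by
    exact (constantCoeff_map _ _).trans congr(algebraMap K B $(hφ a)))
  refine ⟨θ (coeff (single k 1) (Ψ (e (.X i)))), fun g ↦ ?_⟩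
  obtain ⟨ev, hev, hevu⟩ := hu g
  rw [← hev]
  let mev : MvPowerSeries (Fin d) B →ₐ[K] MvPowerSeries (Fin d) K := mapAlgHom ev
  have hmm : mev.comp m = AlgHom.id K _ := by
    ext p n
    exact ((coeff_map _ _ _).trans congr(ev $(coeff_map _ _ _))).trans (ev.commutes _)
  have hmC : mev.comp C' = (Algebra.ofId K _).comp ev := by
    ext b : 1
    exact map_C _ _
  have : Φ g = mev.comp Ψ := by
    apply specMap_comp_injective j
    rw [hΦj, specMap_comp, Category.assoc, hΨj, ModObj.comp_smul, ← Category.assoc,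
      ← Category.assoc, ← specMap_comp, ← specMap_comp, hmC, ← AlgHom.comp_assoc, hmm,
      AlgHom.id_comp, specMap_comp, Category.assoc, hevu, ← Category.assoc,
      toUnit_unique (specMap _ ≫ toUnit _) (toUnit _)]
  change coeff (single k 1) (Φ g (e (.X i))) = _
  rw [this]
  exact coeff_map _ _ _

/-- In suitable formal coordinates at a fixed point, the group preserves the order of power
series in the degree-lexicographic ordering. -/
theorem IsFixedPoint.exists_triangular_germ (hx : IsFixedPoint H x) [IsAffine H.left]
    (hH : RepsHaveEigenvectors H)
    {e : MvPolynomial (Fin d) K →ₐ[K] A} (he : e.toRingHom.Etale)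
    {ε : A →ₐ[K] K} (he0 : ∀ i, ε (e (.X i)) = 0) {j : spec K A ⟶ X} [IsOpenImmersion j.left]
    (hε : specMap ε ≫ j = toUnit _ ≫ x) :
    ∃ φ : A →ₐ[K] MvPowerSeries (Fin d) K, Function.Injective (φ.comp e) ∧
      ∀ g : 𝟙_ (Over (Spec (.of K))) ⟶ H,
        ∃ ψ : MvPowerSeries (Fin d) K →ₐ[K] MvPowerSeries (Fin d) K,
          (∀ p, degLexOrder (ψ p) = degLexOrder p) ∧
          specMap ψ ≫ specMap φ ≫ j =
            (toUnit (spec K (MvPowerSeries (Fin d) K)) ≫ g) • (specMap φ ≫ j) := by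
  obtain ⟨φ, Φ, ρ, hφX, hφ, hΦ, hΦj, hρ, hρc⟩ := hx.exists_germ_action he he0 hε
  obtain ⟨P, P', hPP, htri⟩ := hH.exists_conj_triangular hρ
  have hPP' : P' * P = 1 := mul_eq_one_comm.mp hPP
  let l (Q : Matrix (Fin d) (Fin d) K) (i : Fin d) : MvPowerSeries (Fin d) K :=
    ∑ k, Q i k • MvPowerSeries.X k
  have hl0 (Q) (i) : constantCoeff (l Q i) = 0 := by simp [l]
  have hl1 (Q) (i k) : coeff (single k 1) (l Q i) = Q i k := by
    simp [l, coeff_X, Finsupp.single_left_inj]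
  have hls (Q) : HasSubst (l Q) := hasSubst_of_constantCoeff_zero (hl0 Q)
  choose L hL using fun Q ↦ exists_algHom_eq_subst (hl0 Q)
  have hLX (Q) (i) : L Q (MvPowerSeries.X i) = l Q i := by rw [hL, subst_X (hls Q)]
  have hLsum (Q : Matrix (Fin d) (Fin d) K)
      (T : MvPowerSeries (Fin d) K →ₐ[K] MvPowerSeries (Fin d) K) (i) :
      T (l Q i) = ∑ k, Q i k • T (MvPowerSeries.X k) := by simp [l]
  have hinv {Q Q' : Matrix (Fin d) (Fin d) K} (hQ : Q * Q' = 1) (v : Fin d → MvPowerSeries (Fin d) K)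
      (i) : ∑ k, Q i k • ∑ m, Q' k m • v m = v i := by
    simp_rw [Finset.smul_sum, smul_smul]
    rw [Finset.sum_comm]
    simp_rw [← Finset.sum_smul, ← Matrix.mul_apply, hQ, Matrix.one_apply]
    simp
  have hLL (p) : L P (L P' p) = p := by
    have h (i) : L P (l P' i) = MvPowerSeries.X i := by
      have := hLsum P' (L P) i
      simp only [hLX] at this
      rw [hinv hPP'] at this
      exact this
    have h' := subst_comp_subst_apply (hls P') (hls P) p
    simp_rw [← hL, h] at h'
    rw [h', subst_self]
    rfl
  refine ⟨(L P').comp φ, ?_, fun g ↦ ?_⟩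
  · have h : φ.comp e = (MvPolynomial.coeToMvPowerSeries.algHom K : _ →ₐ[K] _) := by
      apply MvPolynomial.algHom_ext
      simp [hφX]
    rw [AlgHom.comp_assoc, h]
    exact (Function.LeftInverse.injective hLL).comp (MvPolynomial.coe_injective _ _)
  -- The new chart sends the old coordinates to the linear forms `l P'`, so X_i is the combination
  -- of their images with coefficients from row i of P. Thus b i is the translate of X_i by g, with
  -- linear part given by P ρ(g) P'.
  let b (i : Fin d) : MvPowerSeries (Fin d) K := ∑ k, P i k • L P' (Φ g (e (.X k)))
  have hL0 (p) : constantCoeff (L P' p) = constantCoeff p := by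
    rw [hL]
    exact constantCoeff_subst_of_constantCoeff_eq_zero (hl0 P') p
  have hb0 (i) : constantCoeff (b i) = 0 := by
    simp [b, hL0, hΦ, he0]
  have hb1 (i k) : coeff (single k 1) (b i) = (P * (ρ g : Matrix (Fin d) (Fin d) K) * P') i k := by
    have (m : Fin d) : coeff (single k 1) (L P' (Φ g (e (.X m)))) =
        ((ρ g : Matrix (Fin d) (Fin d) K) * P') m k :=
      by simp_rw [hL, coeff_single_one_subst (hl0 P'), hl1, ← hρc, Matrix.mul_apply]
    rw [Matrix.mul_assoc, Matrix.mul_apply]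
    simp [b, this]
  have hbs : HasSubst b := hasSubst_of_constantCoeff_zero hb0
  have hne (i) : (P * (ρ g : Matrix (Fin d) (Fin d) K) * P') i i ≠ 0 := by
    have hdet : (P * (ρ g : Matrix (Fin d) (Fin d) K) * P').det ≠ 0 := by
      rw [Matrix.det_mul, Matrix.det_mul, mul_right_comm, ← Matrix.det_mul, hPP, Matrix.det_one,
        one_mul]
      exact ((Matrix.isUnit_iff_isUnit_det _).mp (ρ g).isUnit).ne_zero
    rw [Matrix.det_of_isLowerTriangular _ fun i k hik ↦ htri g i k hik] at hdet
    exact Finset.prod_ne_zero_iff.mp hdet i (Finset.mem_univ i)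
  obtain ⟨ψ, hψ⟩ := exists_algHom_eq_subst hb0
  refine ⟨ψ, fun p ↦ ?_, ?_⟩
  · rw [hψ]
    exact degLexOrder_subst hbs (fun i ↦ degLexOrder_eq_single i (hb0 i)
      (by rw [hb1]; exact hne i) fun k hik ↦ by rw [hb1]; exact htri g i k hik) p
  -- Both sides agree on coordinates and constant terms, so étale uniqueness applies.
  · have key : ψ.comp ((L P').comp φ) = (L P').comp (Φ g) := by
      refine algHom_ext_of_formallyUnramified (RingHom.Etale.formallyUnramified _ he)
        (fun i ↦ ?_) fun a ↦ ?_
      · have h := hLsum P' ψ i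
        simp only [hψ (MvPowerSeries.X _), subst_X hbs] at h
        rw [hinv hPP'] at h
        rw [AlgHom.comp_apply, AlgHom.comp_apply, hφX, hLX]
        exact h
      · simp [hψ, constantCoeff_subst_of_constantCoeff_eq_zero hb0, hL0, hφ, hΦ]
    rw [← Category.assoc, ← specMap_comp, key, specMap_comp, specMap_comp, Category.assoc,
      Category.assoc, hΦj, ModObj.comp_smul, ← Category.assoc (specMap _) (toUnit _),
      toUnit_unique (specMap _ ≫ toUnit _) (toUnit _)]

end TriangularGerms
/-! ### The generic point of an étale chart -/

section Generic

/-- V is the complement of the finitely many other irreducible components. Any open set that meets V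
therefore contains P. -/
lemma exists_isOpen_forall_le {A : Type*} [CommRing A] [IsNoetherianRing A] {P : PrimeSpectrum A}
    (hP : P.asIdeal ∈ minimalPrimes A) :
    ∃ V : Set (PrimeSpectrum A), IsOpen V ∧ P ∈ V ∧ ∀ Q ∈ V, P ≤ Q := by
  let Z := ⋃ I ∈ minimalPrimes A \ {P.asIdeal}, PrimeSpectrum.zeroLocus (I : Set A)
  have hZ : IsClosed Z := (Set.Finite.subset (minimalPrimes.finite_of_isNoetherianRing A)
    Set.sdiff_subset).isClosed_biUnion fun I _ ↦ PrimeSpectrum.isClosed_zeroLocus _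
  refine ⟨Zᶜ, hZ.isOpen_compl, fun h ↦ ?_, fun Q hQ ↦ ?_⟩
  · simp only [Z, Set.mem_iUnion] at h
    obtain ⟨I, ⟨hI, hne⟩, hIP⟩ := h
    exact hne (le_antisymm hIP (hP.2 ⟨hI.1.1, bot_le⟩ hIP))
  · obtain ⟨I, hI, hIQ⟩ := Ideal.exists_minimalPrimes_le (I := ⊥) (J := Q.asIdeal) bot_le
    by_cases hIP : I = P.asIdeal
    · rwa [hIP] at hIQ
    · refine absurd ?_ hQ
      simp only [Z, Set.mem_iUnion]
      exact ⟨I, ⟨hI, hIP⟩, hIQ⟩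

/-- A prime inside the kernel also contracts to zero in R. Étale maps are quasi-finite, so there are
no strict inclusions between primes of one fibre. -/
lemma ker_mem_minimalPrimes {R A L : Type*} [CommRing R] [CommRing A] [CommRing L] [IsDomain L]
    {e : R →+* A} (he : e.Etale) {φ : A →+* L} (hφ : Function.Injective (φ.comp e)) :
    RingHom.ker φ ∈ minimalPrimes A := by
  algebraize [e]
  refine ⟨⟨RingHom.ker_isPrime φ, bot_le⟩, fun Q hQ hQP ↦ ?_⟩
  have := hQ.1
  have := RingHom.ker_isPrime φ
  have hbot : (RingHom.ker φ).under R = ⊥ := by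
    rw [Ideal.under_def, RingHom.comap_ker]
    exact (RingHom.injective_iff_ker_eq_bot _).mp hφ
  refine (Algebra.QuasiFinite.eq_of_le_of_under_eq (R := R) _ _ hQP ?_).ge
  rw [hbot]
  exact le_bot_iff.mp (hbot ▸ Ideal.comap_mono hQP)

variable {K : Type u} [Field K]

lemma exists_point_mem [IsAlgClosed K] {X : Over (Spec (.of K))} (hX : LocallyOfFiniteType X.hom)
    {U : Set X.left} (hU : IsOpen U) (hne : U.Nonempty) :
    ∃ x : 𝟙_ (Over (Spec (.of K))) ⟶ X, ∀ a, x.left a ∈ U := by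
  have : JacobsonSpace X.left := LocallyOfFiniteType.jacobsonSpace X.hom
  obtain ⟨p, hpU, hp⟩ := nonempty_inter_closedPoints hne hU.isLocallyClosed
  refine ⟨Over.homMk (pointOfClosedPoint X.hom p hp) (pointOfClosedPoint_comp X.hom p hp),
    fun a ↦ ?_⟩
  have := pointOfClosedPoint_apply X.hom p hp a
  rwa [← this] at hpU

lemma isOpenImmersion_whiskerLeft_left {S : Scheme.{u}} (H : Over S) {X Y : Over S} (j : X ⟶ Y)
    [IsOpenImmersion j.left] : IsOpenImmersion (H ◁ j).left := by
  rw [Over.whiskerLeft_left]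
  infer_instance

lemma isFiniteType_of_etale {d : ℕ} {A : Type u} [CommRing A] [Algebra K A]
    {e : MvPolynomial (Fin d) K →ₐ[K] A} (he : e.toRingHom.Etale) : Algebra.FiniteType K A := by
  have h : (algebraMap K A) = e.toRingHom.comp (algebraMap K (MvPolynomial (Fin d) K)) :=
    e.comp_algebraMap.symm
  rw [← RingHom.finiteType_algebraMap, h]
  refine RingHom.FiniteType.comp ?_ (RingHom.finiteType_algebraMap.mpr inferInstance)
  algebraize [e.toRingHom]
  exact RingHom.finiteType_algebraMap.mpr inferInstance

lemma locallyOfFiniteType_spec {A : Type u} [CommRing A] [Algebra K A]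
    [h : Algebra.FiniteType K A] : LocallyOfFiniteType (spec K A).hom :=
  (HasRingHomProperty.Spec_iff (P := @LocallyOfFiniteType)).mpr
    (RingHom.finiteType_algebraMap.mpr h)

/-- The generic point of a component of the source of a chart belongs to many translates of a dense
open subset of `H × X`. -/
lemma exists_point_mem_of_dense [IsAlgClosed K] {H X : Over (Spec (.of K))}
    (hH : LocallyOfFiniteType H.hom) {A : Type u} [CommRing A] [Algebra K A]
    [Algebra.FiniteType K A] {j : spec K A ⟶ X} [IsOpenImmersion j.left]
    {W : (H ⊗ X).left.Opens} (hW : Dense (W : Set (H ⊗ X).left)) {P : PrimeSpectrum A}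
    (hP : P.asIdeal ∈ minimalPrimes A) {O : Set H.left} (hO : IsOpen O) (hne : O.Nonempty) :
    ∃ h : 𝟙_ (Over (Spec (.of K))) ⟶ H, (∀ a, h.left a ∈ O) ∧
      (lift (toUnit _ ≫ h) j).left P ∈ W := by
  have : IsNoetherianRing A := Algebra.FiniteType.isNoetherianRing K A
  obtain ⟨V, hV, hPV, hVP⟩ : ∃ V : Set (spec K A).left, IsOpen V ∧ P ∈ V ∧
    ∀ Q : PrimeSpectrum A, Q ∈ V → P ≤ Q := exists_isOpen_forall_le hP
  have hA : LocallyOfFiniteType (spec K A).hom := locallyOfFiniteType_spec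
  have hHA : LocallyOfFiniteType (H ⊗ spec K A).hom := by
    rw [Over.tensorObj_hom]
    infer_instance
  have := isOpenImmersion_whiskerLeft_left H j
  obtain ⟨h₀, hh₀⟩ := exists_point_mem hH hO hne
  obtain ⟨v₀, hv₀⟩ := exists_point_mem hA hV ⟨P, hPV⟩
  -- A `K`-point (h, v) is chosen in O × V and over W. As v is a specialization of P, the point at P
  -- of the slice over h generizes one in the open set W, so it lies in W too.
  let M : Set (H ⊗ spec K A).left := (fst H (spec K A)).left ⁻¹' O ∩ (snd H (spec K A)).left ⁻¹' V
  have hM : IsOpen M := (hO.preimage (fst H (spec K A)).left.continuous).inter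
    (hV.preimage (snd H (spec K A)).left.continuous)
  have hMne : M.Nonempty := by
    let a : (𝟙_ (Over (Spec (.of K)))).left := IsLocalRing.closedPoint K
    refine ⟨(lift h₀ v₀).left a, ?_, ?_⟩
    · rw [Set.mem_preimage, ← Scheme.Hom.comp_apply, ← Over.comp_left, lift_fst]
      exact hh₀ a
    · rw [Set.mem_preimage, ← Scheme.Hom.comp_apply, ← Over.comp_left, lift_snd]
      exact hv₀ a
  have hWd : Dense ((H ◁ j).left ⁻¹' W) :=
    hW.preimage (Scheme.Hom.isOpenEmbedding (H ◁ j).left).isOpenMap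
  obtain ⟨z, hz⟩ := exists_point_mem hHA
    (hM.inter (W.2.preimage (H ◁ j).left.continuous)) (hWd.inter_open_nonempty M hM hMne)
  refine ⟨z ≫ fst _ _, fun a ↦ ?_, ?_⟩
  · rw [Over.comp_left, Scheme.Hom.comp_apply]
    exact (hz a).1.1
  let a : (𝟙_ (Over (Spec (.of K)))).left := IsLocalRing.closedPoint K
  let c := lift (toUnit (spec K A) ≫ z ≫ fst _ _) j
  have hc : (z ≫ snd _ _) ≫ c = z ≫ H ◁ j := by
    refine CartesianMonoidalCategory.hom_ext _ _ ?_ ?_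
    · rw [Category.assoc _ c, lift_fst, ← Category.assoc (z ≫ _),
        toUnit_unique ((z ≫ _) ≫ toUnit _) (𝟙 _), Category.id_comp, Category.assoc,
        whiskerLeft_fst]
    · simp [c]
  have hle : P ≤ (z ≫ snd H (spec K A)).left a := by
    refine hVP _ ?_
    rw [Over.comp_left, Scheme.Hom.comp_apply]
    exact (hz a).1.2
  refine (((PrimeSpectrum.le_iff_specializes _ _).mp hle).map c.left.continuous).mem_open W.2 ?_
  rw [← Scheme.Hom.comp_apply, ← Over.comp_left, hc, Over.comp_left, Scheme.Hom.comp_apply]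
  exact (hz a).2

end Generic
/-! ### Specialization along a valuation ring and the fixed point -/

section Specialization

variable {K : Type u} [Field K] {H Y : Over (Spec (.of K))} [GrpObj H] [ModObj H Y]

lemma exists_specMap_comp_eq_of_isProper {O L : Type u} [CommRing O] [IsDomain O] [ValuationRing O]
    [Algebra K O] [Field L] [Algebra K L] [Algebra O L] [IsScalarTower K O L] [IsFractionRing O L]
    {Y : Over (Spec (.of K))} (hY : IsProper Y.hom) (t : spec K L ⟶ Y) :
    ∃ y : spec K O ⟶ Y, specMap (IsScalarTower.toAlgHom K O L) ≫ y = t := by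
  have hv := hY
  rw [IsProper.eq_valuativeCriterion] at hv
  let s : ValuativeCommSq Y.hom :=
    { R := O
      K := L
      i₁ := t.left
      i₂ := (spec K O).hom
      commSq := ⟨(Over.w t).trans (Over.w (specMap (IsScalarTower.toAlgHom K O L))).symm⟩ }
  obtain ⟨⟨l, -⟩⟩ := hv.1.1.1 s
  refine ⟨Over.homMk l.default.l l.default.fac_right, ?_⟩
  ext1
  exact l.default.fac_left

/-- An injective ring map is dominant on spectra, and morphisms from a reduced scheme to a separated
one are determined on a dense image. -/
lemma specMap_comp_cancel {A B : Type u} [CommRing A] [Algebra K A] [CommRing B] [Algebra K B]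
    [_root_.IsReduced A] [IsSeparated Y.hom] {f : A →ₐ[K] B} (hf : Function.Injective f)
    {a b : spec K A ⟶ Y} (h : specMap f ≫ a = specMap f ≫ b) : a = b := by
  have hd : IsDominant (specMap f).left := by
    refine ⟨(PrimeSpectrum.denseRange_comap_iff_ker_le_nilRadical f.toRingHom).mpr ?_⟩
    rw [(RingHom.injective_iff_ker_eq_bot f.toRingHom).mp hf]
    exact bot_le
  have : IsReduced (spec K A).left := inferInstanceAs (IsReduced (Spec (.of A)))
  ext1
  exact ext_of_isDominant_of_isSeparated Y.hom ((Over.w a).trans (Over.w b).symm) (specMap f).left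
    congr(($h).left)

/-- y is the value at the closed point of the extension of t to the valuation ring, so one y serves
all h. The relation between t and its translate extends from L to the valuation ring by density; at
the closed point ψ acts trivially and the relation becomes h • y = y. -/
lemma exists_invariant_point {P : Type u} {Γ : Type*} [CommRing P] [IsDomain P] [Algebra K P]
    [AddCommMonoid Γ] [LinearOrder Γ] [IsOrderedCancelAddMonoid Γ] {w : P → WithTop Γ}
    (hw : IsLineOrder K w)
    (hY : IsProper Y.hom) (t : spec K (FractionRing P) ⟶ Y) :
    ∃ y : 𝟙_ (Over (Spec (.of K))) ⟶ Y, ∀ (h : 𝟙_ (Over (Spec (.of K))) ⟶ H) (ψ : P →ₐ[K] P)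
      (Ψ : FractionRing P →ₐ[K] FractionRing P), (∀ p, w (ψ p) = w p) →
      (∀ p, Ψ (algebraMap P _ p) = algebraMap P _ (ψ p)) →
      specMap Ψ ≫ t = (toUnit (spec K (FractionRing P)) ≫ h) • t → h • y = y := by
  have : IsScalarTower K hw.valuationSubring (FractionRing P) := .of_algebraMap_eq fun c ↦
    IsScalarTower.algebraMap_apply K P (FractionRing P) c
  obtain ⟨y, hy⟩ := exists_specMap_comp_eq_of_isProper (O := hw.valuationSubring) hY t
  refine ⟨(unitToSpec K ≫ specMap hw.residueHom) ≫ y, fun h ψ Ψ hψ hΨ ht' ↦ ?_⟩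
  obtain ⟨ψ', -, hψ', hres⟩ := hw.exists_extension hψ
  let i := IsScalarTower.toAlgHom K hw.valuationSubring (FractionRing P)
  have hi : i.comp ψ' = Ψ.comp i := by
    ext z
    obtain ⟨p, q, hq, -, hz⟩ := hw.exists_rep z
    have hq' : algebraMap P (FractionRing P) (ψ q) ≠ 0 := by
      rw [← hΨ]
      exact (map_ne_zero Ψ).mpr (by simpa using hq)
    apply mul_right_cancel₀ hq'
    have h1 : z * hw.toValuationSubring q = hw.toValuationSubring p := Subtype.ext hz
    have h2 : i (ψ' z) * algebraMap P (FractionRing P) (ψ q) =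
        algebraMap P (FractionRing P) (ψ p) := by
      have := congr(i (ψ' $h1))
      rwa [map_mul, map_mul, hψ', hψ'] at this
    have h3 := congr(Ψ $hz)
    rw [map_mul, hΨ, hΨ] at h3
    exact h2.trans h3.symm
  have key : specMap ψ' ≫ y = (toUnit (spec K hw.valuationSubring) ≫ h) • y := by
    refine specMap_comp_cancel (f := i) Subtype.val_injective ?_
    rw [← Category.assoc, ← specMap_comp, hi, specMap_comp, Category.assoc, hy, ht',
      ModObj.comp_smul, hy, ← Category.assoc (specMap i),
      toUnit_unique (specMap i ≫ toUnit _) (toUnit _)]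
  have h1 : h = (unitToSpec K ≫ specMap hw.residueHom) ≫ toUnit _ ≫ h := by
    rw [← Category.assoc, toUnit_unique (_ ≫ toUnit _) (𝟙 _), Category.id_comp]
  nth_rw 1 [h1]
  rw [← ModObj.comp_smul, ← key, Category.assoc, ← Category.assoc (specMap _), ← specMap_comp,
    hres, ← Category.assoc]

/-- The orbit map of y and the constant map agree on a dense set, hence on the reduced scheme `H`.
Pulling back this identity at the universal point of `H` gives it for all T-points. -/
lemma isFixedPoint_of_dense [IsReduced H.left] [IsSeparated Y.hom]
    {y : 𝟙_ (Over (Spec (.of K))) ⟶ Y}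
    (hy : ∀ O : Set H.left, IsOpen O → O.Nonempty →
      ∃ h : 𝟙_ (Over (Spec (.of K))) ⟶ H, (∀ a, h.left a ∈ O) ∧ h • y = y) :
    IsFixedPoint H y := by
  let a : H ⟶ Y := 𝟙 H • (toUnit H ≫ y)
  let b : H ⟶ Y := toUnit H ≫ y
  have hab : a = b := by
    have hd : IsDominant (Limits.equalizer.ι a b).left := by
      refine ⟨dense_iff_inter_open.mpr fun O hO hne ↦ ?_⟩
      obtain ⟨h, hhO, hh⟩ := hy O hO hne
      have hhab : h ≫ a = h ≫ b := by
        rw [ModObj.comp_smul, Category.comp_id, ← Category.assoc,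
          toUnit_unique (h ≫ toUnit _) (𝟙 _), Category.id_comp, hh]
      let p : (𝟙_ (Over (Spec (.of K)))).left := IsLocalRing.closedPoint K
      refine ⟨h.left p, hhO p, (Limits.equalizer.lift h hhab).left p, ?_⟩
      rw [← Scheme.Hom.comp_apply, ← Over.comp_left, Limits.equalizer.lift_ι]
    ext1
    exact ext_of_isDominant_of_isSeparated Y.hom ((Over.w a).trans (Over.w b).symm)
      (Limits.equalizer.ι a b).left congr($(Limits.equalizer.condition a b).left)
  intro T h
  have h1 := congr(h ≫ $hab)
  rwa [ModObj.comp_smul, Category.comp_id, ← Category.assoc,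
    toUnit_unique (h ≫ toUnit _) (toUnit _)] at h1

end Specialization
-- The generic formal point and the conclusion
lemma exists_extension_fractionRing {K P : Type*} [Field K] [CommRing P] [IsDomain P] [Algebra K P]
    {ψ : P →ₐ[K] P} (hψ : Function.Injective ψ) :
    ∃ Ψ : FractionRing P →ₐ[K] FractionRing P,
      ∀ p, Ψ (algebraMap P _ p) = algebraMap P _ (ψ p) :=
  have h : Function.Injective ((IsScalarTower.toAlgHom K P (FractionRing P)).comp ψ) :=
    (IsFractionRing.injective P (FractionRing P)).comp hψ
  ⟨IsFractionRing.liftAlgHom h, fun p ↦ IsFractionRing.lift_algebraMap h p⟩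

lemma specMap_left_eq_ker {K A L : Type u} [Field K] [CommRing A] [Algebra K A] [Field L]
    [Algebra K L] (φ : A →ₐ[K] L) (a : (spec K L).left) :
    (specMap φ).left a = (⟨RingHom.ker φ.toRingHom, RingHom.ker_isPrime _⟩ : PrimeSpectrum A) := by
  refine PrimeSpectrum.ext ?_
  have h : (show PrimeSpectrum L from a).asIdeal = ⊥ :=
    Subsingleton.elim (α := PrimeSpectrum L) a ⊥ ▸ rfl
  change Ideal.comap φ.toRingHom (show PrimeSpectrum L from a).asIdeal = _
  rw [h]
  rfl

lemma exists_comp_inclOver_eq {S : Scheme.{u}} {T X Y : Over S} (g : X.left.PartialMap Y.left)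
    (t : T ⟶ X) (ht : ∀ a, t.left a ∈ g.domain) : ∃ t' : T ⟶ domainOver g, t' ≫ inclOver g = t := by
  have hr : Set.range t.left ⊆ Set.range g.domain.ι := by
    rw [Scheme.Opens.range_ι]
    rintro _ ⟨a, rfl⟩
    exact ht a
  refine ⟨Over.homMk (IsOpenImmersion.lift g.domain.ι t.left hr) ?_, ?_⟩
  · exact (IsOpenImmersion.lift_fac_assoc _ _ _ _).trans (Over.w t)
  · ext1
    exact IsOpenImmersion.lift_fac _ _ _

end GoingDown

open GoingDown in
theorem mainTheorem1 {K : Type u} [Field K] [IsAlgClosed K]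
    (H : Over (Spec (.of K))) [GrpObj H] (hH : GoingDown.IsLinearAlgebraicGroup H)
    (hU : GoingDown.IsUnipotentByAbelian H ∨ GoingDown.RepsHaveEigenvectors H)
    (X Y : Over (Spec (.of K))) [ModObj H X] [ModObj H Y]
    (f : X.left ⤏ Y.left) (hf : GoingDown.IsEquivariant H f)
    (hX : ∃ x : 𝟙_ (Over (Spec (.of K))) ⟶ X,
      GoingDown.IsFixedPoint H x ∧ GoingDown.IsSmoothPoint x)
    (hY : IsProper Y.hom) :
    ∃ y : 𝟙_ (Over (Spec (.of K))) ⟶ Y, GoingDown.IsFixedPoint H y := by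
  have hrep : RepsHaveEigenvectors H := hU.elim (fun h ↦ h.repsHaveEigenvectors) id
  have := hH.isAffine
  have := hH.isReduced
  obtain ⟨x, hx, hxs⟩ := hX
  obtain ⟨g, hg, -, W, hWd, hW⟩ := hf
  obtain ⟨d, A, _, _, e, ε, j, he, he0, hj, hε⟩ := exists_etale_chart hxs
  obtain ⟨φ, hφe, hφ⟩ := hx.exists_triangular_germ hrep he he0 hε
  have := isFiniteType_of_etale he
  have : IsNoetherianRing A := Algebra.FiniteType.isNoetherianRing K A
  have : IsDomain (MvPowerSeries (Fin d) K) := NoZeroDivisors.to_isDomain _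
  let L := FractionRing (MvPowerSeries (Fin d) K)
  let i : MvPowerSeries (Fin d) K →ₐ[K] L := IsScalarTower.toAlgHom K _ L
  have hi : Function.Injective i := IsFractionRing.injective _ L
  let p : PrimeSpectrum A := ⟨RingHom.ker (i.comp φ).toRingHom, RingHom.ker_isPrime _⟩
  have hp : p.asIdeal ∈ minimalPrimes A :=
    ker_mem_minimalPrimes (φ := (i.comp φ).toRingHom) he (hi.comp hφe)
  -- The generic point of a component lies in every dense open set, in particular in the domain of
  -- g.
  have hpg : j.left p ∈ g.domain := by
    obtain ⟨V, hV, hpV, hVp⟩ : ∃ V : Set (spec K A).left, IsOpen V ∧ p ∈ V ∧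
      ∀ Q : PrimeSpectrum A, Q ∈ V → p ≤ Q := exists_isOpen_forall_le hp
    have hd : Dense (j.left ⁻¹' g.domain) :=
      g.dense_domain.preimage (Scheme.Hom.isOpenEmbedding j.left).isOpenMap
    obtain ⟨q, hqV, hq⟩ := hd.inter_open_nonempty V hV ⟨p, hpV⟩
    exact (((PrimeSpectrum.le_iff_specializes _ _).mp (hVp q hqV)).map
      j.left.continuous).mem_open g.domain.2 hq
  obtain ⟨ξ, hξ⟩ := exists_comp_inclOver_eq g (specMap (i.comp φ) ≫ j) (fun a ↦ by
    rw [Over.comp_left, Scheme.Hom.comp_apply, specMap_left_eq_ker]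
    exact hpg)
  obtain ⟨y, hy⟩ := exists_invariant_point (H := H) (isLineOrder_degLexOrder (σ := Fin d) (K := K))
    hY (ξ ≫ homOver g hg)
  refine ⟨y, isFixedPoint_of_dense fun O hO hne ↦ ?_⟩
  obtain ⟨h, hhO, hhW⟩ := exists_point_mem_of_dense hH.finiteType (j := j) hWd hp hO hne
  obtain ⟨ψ, hψ, hψj⟩ := hφ h
  have hψi : Function.Injective ψ := (injective_iff_map_eq_zero ψ).mpr fun a ha ↦ by
    rw [← degLexOrder_eq_top, ← hψ, ha, degLexOrder_eq_top]
  obtain ⟨Ψ, hΨ⟩ := exists_extension_fractionRing hψi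
  refine ⟨h, hhO, hy h ψ Ψ hψ hΨ ?_⟩
  rw [← Category.assoc]
  -- The translate of the generic formal point by h is its pullback along Ψ. It therefore factors
  -- through the domain as well, and equivariance on W applies.
  refine hW (spec K L) (toUnit _ ≫ h) ξ (specMap Ψ ≫ ξ) ?_ ?_
  · have hl : lift (toUnit (spec K L) ≫ h) (ξ ≫ inclOver g) =
        specMap (i.comp φ) ≫ lift (toUnit _ ≫ h) j := by
      rw [hξ, comp_lift, ← Category.assoc _ (toUnit _),
        toUnit_unique (specMap (i.comp φ) ≫ toUnit _) (toUnit _)]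
    rintro _ ⟨a, rfl⟩
    rw [hl, Over.comp_left, Scheme.Hom.comp_apply, specMap_left_eq_ker]
    exact hhW
  · have hΨi : Ψ.comp i = i.comp ψ := AlgHom.ext hΨ
    rw [Category.assoc, hξ, specMap_comp, Category.assoc, ← Category.assoc (specMap Ψ),
      ← specMap_comp, hΨi, specMap_comp, Category.assoc, hψj, ModObj.comp_smul,
      ← Category.assoc (specMap i) (toUnit _), toUnit_unique (specMap i ≫ toUnit _) (toUnit _)]
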